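/- Let $\beta\in(0,1/2]$, $\bar\beta=1-\beta$ and $\alpha\in(0,1)$. Consider the critical Bienaymé–Galton–Watson tree with offspring distribution $P(Z=0)=P(Z=2)=\beta\bar\beta$, $P(Z=1)=\beta^2+\bar\beta^2$, and attach to its nodes i.i.d. random variables $X_i$, independent of the tree, with $P(X_i=1)=\alpha$ and $P(X_i=-1)=1-\alpha$. For a finite tree the runoff from node $i$ is defined recursively by $W_i=\bigl(X_i+\sum_{j\to i}W_j\bigr)\vee 0$, the sum being over the offspring $j$ of $i$. Let $W^{(n)}$ be the runoff from the root in the tree truncated at generation $n$ (it is non-decreasing in $n$), and let $W=\lim_{n\to\infty}W^{(n)}\in[0,\infty]$ be the root runoff. Put $$\alpha_c=\tfrac12\Bigl(1+\beta\bar\beta-\sqrt{\beta\bar\beta(2+\beta\bar\beta)}\Bigr),\qquad h(t)=\frac{t\,[1-\alpha(4\beta\bar\beta+t)-\alpha^2(1-2\beta)^2(1-t^2)]}{4(1-\alpha)\beta^2\bar\beta^2\,(1-\alpha(1-t^2))}.$$ Then $h$ attains its maximum over $[0,1]$ at exactly one point $t_0$, and the following hold. 1. If $\alpha=\alpha_c$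 then, as $x\to\infty$, $\;P(W>x)\sim\sqrt{\dfrac{-h''(1)(1-\alpha)}{8\pi}}\;x^{-3/2}$. 2. If $\alpha>\alpha_c$ then, as $x\to\infty$, $\;P(W>x)\sim\sqrt{\dfrac{(h(t_0)-h(1))(1-\alpha)}{\pi}}\;x^{-1/2}$. 3. If $\alpha<\alpha_c$ then all positive moments of $W$ are finite: $E[W^r]<\infty$ for every real $r>0$. -/

import Mathlib

open MeasureTheory ProbabilityTheory Filter Topology Asymptotics

/-- A family of random variables, indexed by the nodes of the Ulam-Harris tree `List ℕ` (the root is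
`[]`, the children of `v` are `v ++ [0], v ++ [1], …`), which encodes the critical Bienaymé-Galton-Watson
tree with offspring law `P(Z=0) = β(1-β)`, `P(Z=1) = β² + (1-β)²`, `P(Z=2) = β(1-β)`, whose nodes carry
i.i.d. marks with `P(X=1) = α`, `P(X=-1) = 1-α`, independent of the tree.
`Z v` is the number of offspring of `v` and `X v` its point contribution
(rainfall minus infiltration). -/
structure IsRunoffModel {Ω : Type*} [MeasurableSpace Ω] (P : Measure Ω) (α β : ℝ)
    (Z : List ℕ → Ω → ℕ) (X : List ℕ → Ω → ℝ) : Prop where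
  measurable_offspring : ∀ v, Measurable (Z v)
  measurable_contribution : ∀ v, Measurable (X v)
  /-- The pairs attached to different nodes are independent. -/
  indep_nodes : iIndepFun (fun (v : List ℕ) (ω : Ω) => (Z v ω, X v ω)) P
  /-- At each node the offspring number and the contribution are independent. -/
  indep_offspring_contribution : ∀ v, IndepFun (Z v) (X v) P
  offspring_zero : ∀ v, P {ω | Z v ω = 0} = ENNReal.ofReal (β * (1 - β))
  offspring_one : ∀ v, P {ω | Z v ω = 1} = ENNReal.ofReal (β ^ 2 + (1 - β) ^ 2)
  offspring_two : ∀ v, P {ω | Z v ω = 2} = ENNReal.ofReal (β * (1 - β))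
  contribution_one : ∀ v, P {ω | X v ω = 1} = ENNReal.ofReal α
  contribution_neg_one : ∀ v, P {ω | X v ω = -1} = ENNReal.ofReal (1 - α)

/-- The runoff from node `v` of the tree with offspring numbers `z` and contributions `x`, when only the
descendants of `v` up to `n` generations above `v` are kept: `W_v = (x_v + ∑_{j → v} W_j) ∨ 0`. -/
noncomputable def truncatedRunoff (z : List ℕ → ℕ) (x : List ℕ → ℝ) : ℕ → List ℕ → ℝ
  | 0, v => max (x v) 0
  | n + 1, v => max (x v + ∑ i ∈ Finset.range (z v), truncatedRunoff z x n (v ++ [i])) 0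

/-- The runoff from the root: the limit (the supremum, see `tendsto_truncatedRunoff`) of the root runoff
of the tree truncated at generation `n`. It may a priori be infinite. -/
noncomputable def rootRunoff (z : List ℕ → ℕ) (x : List ℕ → ℝ) : ENNReal :=
  ⨆ n, ENNReal.ofReal (truncatedRunoff z x n [])

theorem truncatedRunoff_nonneg (z : List ℕ → ℕ) (x : List ℕ → ℝ) (n : ℕ) (v : List ℕ) :
    0 ≤ truncatedRunoff z x n v := by
  cases n <;> exact le_max_right _ _

theorem truncatedRunoff_le_succ (z : List ℕ → ℕ) (x : List ℕ → ℝ) (n : ℕ) (v : List ℕ) :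
    truncatedRunoff z x n v ≤ truncatedRunoff z x (n + 1) v := by
  induction n generalizing v with
  | zero =>
    have h := Finset.sum_nonneg (s := Finset.range (z v))
      (fun i _ => truncatedRunoff_nonneg z x 0 (v ++ [i]))
    exact max_le_max (by linarith) le_rfl
  | succ n ih =>
    have h := Finset.sum_le_sum (s := Finset.range (z v)) (fun i _ => ih (v ++ [i]))
    exact max_le_max (by linarith) le_rfl

theorem tendsto_truncatedRunoff (z : List ℕ → ℕ) (x : List ℕ → ℝ) :
    Tendsto (fun n => ENNReal.ofReal (truncatedRunoff z x n [])) atTop (𝓝 (rootRunoff z x)) :=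
  tendsto_atTop_iSup (monotone_nat_of_le_succ fun n =>
    ENNReal.ofReal_le_ofReal (truncatedRunoff_le_succ z x n []))

/-- The critical value `α_c(β)`. -/
noncomputable def criticalAlpha (β : ℝ) : ℝ :=
  (1 / 2) * (1 + β * (1 - β) - √(β * (1 - β) * (2 + β * (1 - β))))

/-- The rational function `h`. -/
noncomputable def runoffH (α β t : ℝ) : ℝ :=
  t * (1 - α * (4 * β * (1 - β) + t) - α ^ 2 * (1 - 2 * β) ^ 2 * (1 - t ^ 2)) /
    (4 * (1 - α) * β ^ 2 * (1 - β) ^ 2 * (1 - α * (1 - t ^ 2)))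

/-! Put `p = β(1-β)`, `w k = P(W > k)`, `T(t) = ∑ w k t^k` and `u = (1-t) T(t)`, so that `1 - u` is
the generating function of `W`, with `t^∞ = 0` for `t < 1`. Conditioning on the root gives an
equation quadratic in `u` that also contains the unknown `w 0` (`runoffTail_equation`). Completing
the square gives `signedRoot ^ 2 = (1-t) * gapCubic`, where `gapCubic` is a positive multiple of `M
- h(t)` for a constant level `M` depending on `w 0`.

The level is found from the sign of the root. As a square is nonnegative, `M ≥ h` on `[0,1]`. The
root is positive at `0`; if `gapCubic` had no zero in `[0,1)`, the root would stay positive there,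
and `T ≥ 0` would then force `gapCubic` to vanish at `1` (`exists_gapCubic_eq_zero`). So `M = max
h`, and a root count for the cubic makes the maximiser unique (`gapCubic_zero_unique`).

The behaviour of `T` at `1` now depends on the position of the maximiser. With `α ≤ 1/2`, it is `1`
when `gapQuadratic` is nonnegative at `1`, that is, when `α ≤ α_c`. Above `α_c` the maximiser is
interior, the root is negative to its right, and `T` blows up like `(1-t)^(-1/2)`. At `α_c` the
function `T` is bounded with a `√(1-t)` singularity, and its derivative blows up like
`(1-t)^(-1/2)`. Below `α_c` it extends analytically past `1`, and nonnegative coefficients give all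
moments. In the first two cases Karamata's theorem (`tendsto_partialSum_of_tendsto_abel`) gives the
partial sums, and monotonicity of `w` gives the tail itself
(`tendsto_of_tendsto_partialSum_of_antitone`). -/

/-! ### Reduction to an integer-valued recursion. -/

/-- The runoff recursion with values in `ℕ`, started from `0`, for contributions `±1`. -/
noncomputable def integerRunoff (z : List ℕ → ℕ) (x : List ℕ → ℝ) : ℕ → List ℕ → ℕ
  | 0, _ => 0
  | n + 1, v =>
    if x v = 1 then ∑ i ∈ Finset.range (z v), integerRunoff z x n (v ++ [i]) + 1
    else ∑ i ∈ Finset.range (z v), integerRunoff z x n (v ++ [i]) - 1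

/-- Truncated subtraction on `ℕ` plays the role of the maximum with `0`. The index shifts by one
because the integer recursion starts one generation earlier, from the constant `0`. -/
theorem truncatedRunoff_eq_integerRunoff {z : List ℕ → ℕ} {x : List ℕ → ℝ}
    (hx : ∀ v, x v = 1 ∨ x v = -1) (n : ℕ) (v : List ℕ) :
    truncatedRunoff z x n v = integerRunoff z x (n + 1) v := by
  have key : ∀ (s : ℕ) (v : List ℕ), max (x v + (s : ℝ)) 0 =
      ((if x v = 1 then s + 1 else s - 1 : ℕ) : ℝ) := by
    intro s v
    rcases hx v with h | h
    · rw [if_pos h, h, max_eq_left (by positivity)]; push_cast; ring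
    · rw [if_neg (by rw [h]; norm_num), h]
      rcases Nat.eq_zero_or_pos s with hs | hs
      · simp [hs]
      · rw [Nat.cast_sub hs, max_eq_left]
        · push_cast; ring
        · have : (1 : ℝ) ≤ s := by exact_mod_cast hs
          linarith
  induction n generalizing v with
  | zero => simpa [truncatedRunoff, integerRunoff] using key 0 v
  | succ n ih =>
    rw [truncatedRunoff, integerRunoff, ← key]
    simp only [ih]
    push_cast
    rfl

theorem integerRunoff_le_succ (z : List ℕ → ℕ) (x : List ℕ → ℝ) (n : ℕ) (v : List ℕ) :
    integerRunoff z x n v ≤ integerRunoff z x (n + 1) v := by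
  induction n generalizing v with
  | zero => exact Nat.zero_le _
  | succ n ih =>
    have h := Finset.sum_le_sum (s := Finset.range (z v)) (fun i _ => ih (v ++ [i]))
    rw [integerRunoff, integerRunoff]
    split_ifs <;> omega

/-! ### Dependence of the runoff on the subtree only. -/

section Measurability

variable {Ω : Type*} (Z : List ℕ → Ω → ℕ) (X : List ℕ → Ω → ℝ)

/-- The σ-algebra generated by the data attached to a node. -/
abbrev nodeSigma (v : List ℕ) : MeasurableSpace Ω :=
  MeasurableSpace.comap (fun ω => (Z v ω, X v ω)) inferInstance

/-- The σ-algebra generated by the data attached to a node and its descendants. -/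
abbrev subtreeSigma (v : List ℕ) : MeasurableSpace Ω :=
  ⨆ w ∈ {w : List ℕ | v <+: w}, nodeSigma Z X w

theorem measurable_node (v : List ℕ) :
    Measurable[nodeSigma Z X v] (fun ω => (Z v ω, X v ω)) :=
  comap_measurable _

/-- Siblings have disjoint subtrees, so this is the source of all independence used below. -/
theorem measurable_integerRunoff_subtree (n : ℕ) (v : List ℕ) :
    Measurable[subtreeSigma Z X v]
      (fun ω => integerRunoff (fun v => Z v ω) (fun v => X v ω) n v) := by
  induction n generalizing v with
  | zero => exact @measurable_const _ _ _ (subtreeSigma Z X v) _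
  | succ n ih =>
    let _ : MeasurableSpace Ω := subtreeSigma Z X v
    have hnode : Measurable (fun ω => (Z v ω, X v ω)) :=
      (measurable_node Z X v).mono
        (le_iSup₂_of_le (f := fun w _ => nodeSigma Z X w) v (List.prefix_refl v) le_rfl) le_rfl
    have hchild : ∀ i, Measurable
        (fun ω => integerRunoff (fun v => Z v ω) (fun v => X v ω) n (v ++ [i])) := fun i =>
      (ih (v ++ [i])).mono
        (biSup_mono fun w hw => (List.prefix_append v [i]).trans hw) le_rfl
    have hS : Measurable (fun ω => ∑ i ∈ Finset.range (Z v ω),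
        integerRunoff (fun v => Z v ω) (fun v => X v ω) n (v ++ [i])) := by
      -- The number of summands is random; it is first treated as a separate countable variable and
      -- then replaced by `Z v`.
      have h : Measurable (fun q : ℕ × Ω => ∑ i ∈ Finset.range q.1,
          integerRunoff (fun v => Z v q.2) (fun v => X v q.2) n (v ++ [i])) :=
        measurable_from_prod_countable_right fun k =>
          Finset.measurable_sum (Finset.range k) fun i _ => hchild i
      exact h.comp ((measurable_fst.comp hnode).prodMk measurable_id)
    have hX : MeasurableSet {ω | X v ω = 1} := (measurable_snd.comp hnode) (measurableSet_singleton 1)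
    simp only [integerRunoff]
    exact Measurable.ite hX (hS.add_const 1) ((measurable_of_countable (fun k : ℕ => k - 1)).comp hS)

end Measurability

/-! ### One step of the recursion for generating functions. -/

section Step

variable {Ω : Type*} [MeasurableSpace Ω] {P : Measure Ω} [IsProbabilityMeasure P]

/-- The sum of the runoffs from the children of a node with at most two children. -/
def childSum (z : ℕ) (y : ℕ × ℕ) : ℕ := if z = 0 then 0 else if z = 1 then y.1 else y.1 + y.2

theorem integral_pow_childSum {Y₀ Y₁ : Ω → ℕ} (h₀ : Measurable Y₀) (h₁ : Measurable Y₁)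
    (hY : IndepFun Y₀ Y₁ P) {t g : ℝ}
    (hg₀ : ∫ ω, t ^ Y₀ ω ∂P = g) (hg₁ : ∫ ω, t ^ Y₁ ω ∂P = g) {z : ℕ} (hz : z < 3) :
    ∫ ω, t ^ childSum z (Y₀ ω, Y₁ ω) ∂P = g ^ z := by
  interval_cases z
  · simp [childSum]
  · simpa [childSum] using hg₀
  · simp only [childSum, OfNat.ofNat_ne_zero, OfNat.ofNat_ne_one, if_false, pow_add]
    have hm : Measurable (fun k : ℕ => t ^ k) := measurable_of_countable _
    have := (hY.comp hm hm).integral_fun_mul_eq_mul_integral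
      (hm.comp h₀).aestronglyMeasurable (hm.comp h₁).aestronglyMeasurable
    simp only [Function.comp_apply] at this
    rw [this, hg₀, hg₁, sq]

omit [IsProbabilityMeasure P] in
theorem integral_indicator_mul_of_indepFun {A B : Type*} [MeasurableSpace A] [MeasurableSpace B]
    {ξ : Ω → A} {Y : Ω → B} (hξ : Measurable ξ) (hY : Measurable Y) (h : IndepFun ξ Y P)
    {s : Set A} (hs : MeasurableSet s) {φ : B → ℝ} (hφ : Measurable φ) :
    ∫ ω, s.indicator 1 (ξ ω) * φ (Y ω) ∂P = P.real (ξ ⁻¹' s) * ∫ ω, φ (Y ω) ∂P := by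
  have hm : Measurable (s.indicator (1 : A → ℝ)) := measurable_one.indicator hs
  have := (h.comp hm hφ).integral_fun_mul_eq_mul_integral
      (hm.comp hξ).aestronglyMeasurable (hφ.comp hY).aestronglyMeasurable
  simp only [Function.comp_apply] at this
  rw [this]
  congr 1
  have : (fun ω => s.indicator (1 : A → ℝ) (ξ ω)) = (ξ ⁻¹' s).indicator 1 := by
    rfl
  rw [this, integral_indicator_one (hξ hs)]

/-- The offspring law has generating function `g + p(1-g)^2`. The factor `t` on the left compensates
the unit loss when `χ = -1`; an empty sum loses nothing, which produces the correction in `g₀`, the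
probability of the value `0` (with `0^0 = 1`). -/
theorem integral_pow_runoff_step {ζ : Ω → ℕ} {χ : Ω → ℝ} {Y₀ Y₁ : Ω → ℕ}
    (hζ : Measurable ζ) (hχ : Measurable χ) (h₀ : Measurable Y₀) (h₁ : Measurable Y₁)
    (hY : IndepFun Y₀ Y₁ P) (hζχ : IndepFun ζ χ P)
    (hind : IndepFun (fun ω => (ζ ω, χ ω)) (fun ω => (Y₀ ω, Y₁ ω)) P)
    {α p : ℝ} (hz0 : P.real {ω | ζ ω = 0} = p) (hz1 : P.real {ω | ζ ω = 1} = 1 - 2 * p)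
    (hz2 : P.real {ω | ζ ω = 2} = p) (hx1 : P.real {ω | χ ω = 1} = α)
    (hx2 : P.real {ω | χ ω = -1} = 1 - α)
    (hζ3 : ∀ᵐ ω ∂P, ζ ω < 3) (hχ2 : ∀ᵐ ω ∂P, χ ω = 1 ∨ χ ω = -1)
    {t : ℝ} (ht0 : 0 ≤ t) (ht1 : t ≤ 1) {g g₀ : ℝ}
    (hg₀ : ∫ ω, t ^ Y₀ ω ∂P = g) (hg₁ : ∫ ω, t ^ Y₁ ω ∂P = g)
    (hgz₀ : ∫ ω, (0 : ℝ) ^ Y₀ ω ∂P = g₀) (hgz₁ : ∫ ω, (0 : ℝ) ^ Y₁ ω ∂P = g₀) :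
    t * ∫ ω, t ^ (if χ ω = 1 then childSum (ζ ω) (Y₀ ω, Y₁ ω) + 1
        else childSum (ζ ω) (Y₀ ω, Y₁ ω) - 1) ∂P =
      (α * t ^ 2 + (1 - α)) * (g + p * (1 - g) ^ 2) -
        (1 - α) * (1 - t) * (g₀ + p * (1 - g₀) ^ 2) := by
  set ξ : Ω → ℕ × ℝ := fun ω => (ζ ω, χ ω) with hξdef
  set Y : Ω → ℕ × ℕ := fun ω => (Y₀ ω, Y₁ ω) with hYdef
  have hξm : Measurable ξ := hζ.prodMk hχ
  have hYm : Measurable Y := h₀.prodMk h₁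
  have hsing : ∀ (z : ℕ) (x : ℝ), P.real (ξ ⁻¹' {(z, x)}) =
      P.real {ω | ζ ω = z} * P.real {ω | χ ω = x} := by
    intro z x
    have := hζχ.measure_inter_preimage_eq_mul {z} {x} (measurableSet_singleton z)
      (measurableSet_singleton x)
    have hset : ξ ⁻¹' {(z, x)} = ζ ⁻¹' {z} ∩ χ ⁻¹' {x} := by
      ext ω; simp [hξdef]
    rw [measureReal_def, hset, this, ENNReal.toReal_mul]
    rfl
  let a : ℕ → ℕ × ℕ → ℝ := fun z y => t ^ 2 * t ^ childSum z y
  -- This is `t * t^(S-1)` with truncated subtraction: `t^S` for `S > 0`, and `t = 1 - (1-t)` for `S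
  -- = 0`.
  let b : ℕ → ℕ × ℕ → ℝ := fun z y => t ^ childSum z y - (1 - t) * 0 ^ childSum z y
  have hint : ∀ (s : ℝ) (_ : 0 ≤ s) (_ : s ≤ 1) (z : ℕ),
      Integrable (fun ω => s ^ childSum z (Y ω)) P := fun s hs0 hs1 z =>
    Integrable.of_bound (C := 1)
      ((measurable_of_countable (fun y => s ^ childSum z y)).comp hYm).aestronglyMeasurable
      (Eventually.of_forall fun ω => by
        rw [Real.norm_eq_abs, abs_of_nonneg (by positivity)]; exact pow_le_one₀ hs0 hs1)
  have hae : (fun ω => t * t ^ (if χ ω = 1 then childSum (ζ ω) (Y ω) + 1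
        else childSum (ζ ω) (Y ω) - 1)) =ᵐ[P]
      fun ω => ∑ z ∈ Finset.range 3, (({(z, 1)} : Set (ℕ × ℝ)).indicator 1 (ξ ω) * a z (Y ω) +
        ({(z, -1)} : Set (ℕ × ℝ)).indicator 1 (ξ ω) * b z (Y ω)) := by
    filter_upwards [hζ3, hχ2] with ω h3 h2
    rw [Finset.sum_eq_single (ζ ω)]
    · rcases h2 with h | h
      · simp [hξdef, h, a, Set.indicator]
        norm_num
        ring
      · have : (-1 : ℝ) ≠ 1 := by norm_num
        simp only [hξdef, h, b, Set.indicator, Set.mem_singleton_iff, this, Prod.mk.injEq,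
          if_false, and_false, zero_mul, if_true, Pi.one_apply, one_mul, zero_add]
        rcases Nat.eq_zero_or_pos (childSum (ζ ω) (Y ω)) with hs | hs
        · rw [hs]; simp
        · obtain ⟨k, hk⟩ : ∃ k, childSum (ζ ω) (Y ω) = k + 1 := ⟨_, (Nat.sub_add_cancel hs).symm⟩
          rw [hk]; simp; ring
    · intro z _ hz
      simp [hξdef, Set.indicator, Ne.symm hz]
    · intro h; exact absurd (Finset.mem_range.mpr h3) h
  have hbd : ∀ (s : Set (ℕ × ℝ)) (_ : MeasurableSet s) (φ : ℕ × ℕ → ℝ),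
      Integrable (fun ω => φ (Y ω)) P → Integrable (fun ω => s.indicator 1 (ξ ω) * φ (Y ω)) P := by
    intro s hs φ hφ
    have : (fun ω => s.indicator (1 : ℕ × ℝ → ℝ) (ξ ω) * φ (Y ω)) =
        (ξ ⁻¹' s).indicator (fun ω => φ (Y ω)) := by
      ext ω; by_cases h : ξ ω ∈ s <;> simp [h]
    rw [this]
    exact hφ.indicator (hξm hs)
  have ha : ∀ z, Integrable (fun ω => a z (Y ω)) P := fun z => (hint t ht0 ht1 z).const_mul _
  have hb : ∀ z, Integrable (fun ω => b z (Y ω)) P := fun z =>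
    (hint t ht0 ht1 z).sub ((hint 0 le_rfl zero_le_one z).const_mul _)
  rw [← integral_const_mul, integral_congr_ae hae, integral_finsetSum]
  · have hterm : ∀ z ∈ Finset.range 3,
        ∫ ω, (({(z, 1)} : Set (ℕ × ℝ)).indicator 1 (ξ ω) * a z (Y ω) +
          ({(z, -1)} : Set (ℕ × ℝ)).indicator 1 (ξ ω) * b z (Y ω)) ∂P =
        P.real {ω | ζ ω = z} * (α * (t ^ 2 * g ^ z) + (1 - α) * (g ^ z - (1 - t) * g₀ ^ z)) := by
      intro z hz
      have hz3 := Finset.mem_range.mp hz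
      rw [integral_add (hbd _ (measurableSet_singleton _) _ (ha z))
        (hbd _ (measurableSet_singleton _) _ (hb z)),
        integral_indicator_mul_of_indepFun hξm hYm hind (measurableSet_singleton _)
          (measurable_of_countable (a z)),
        integral_indicator_mul_of_indepFun hξm hYm hind (measurableSet_singleton _)
          (measurable_of_countable (b z)), hsing, hsing, hx1, hx2]
      simp only [a, b]
      rw [integral_const_mul, integral_sub (hint t ht0 ht1 z)
        ((hint 0 le_rfl zero_le_one z).const_mul _), integral_const_mul,
        integral_pow_childSum h₀ h₁ hY hg₀ hg₁ hz3, integral_pow_childSum h₀ h₁ hY hgz₀ hgz₁ hz3]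
      ring
    rw [Finset.sum_congr rfl hterm]
    simp only [Finset.sum_range_succ, Finset.sum_range_zero]
    rw [hz0, hz1, hz2]
    ring
  · intro z _
    exact (hbd _ (measurableSet_singleton _) _ (ha z)).add
      (hbd _ (measurableSet_singleton _) _ (hb z))

end Step

/-! ### The functional equation and the tail of the root runoff. -/

section Model

variable {Ω : Type*} [MeasurableSpace Ω] {P : Measure Ω} [IsProbabilityMeasure P] {α β : ℝ}
  {Z : List ℕ → Ω → ℕ} {X : List ℕ → Ω → ℝ}

/-- The integer-valued runoff as a random variable. -/
noncomputable abbrev runoffVar (Z : List ℕ → Ω → ℕ) (X : List ℕ → Ω → ℝ) (n : ℕ) (v : List ℕ) :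
    Ω → ℕ := fun ω => integerRunoff (fun v => Z v ω) (fun v => X v ω) n v

namespace IsRunoffModel

omit [IsProbabilityMeasure P] in
theorem nodeSigma_le (hM : IsRunoffModel P α β Z X) (v : List ℕ) :
    nodeSigma Z X v ≤ ‹MeasurableSpace Ω› :=
  ((hM.measurable_offspring v).prodMk (hM.measurable_contribution v)).comap_le

omit [IsProbabilityMeasure P] in
theorem measurable_runoffVar (hM : IsRunoffModel P α β Z X) (n : ℕ) (v : List ℕ) :
    Measurable (runoffVar Z X n v) :=
  (measurable_integerRunoff_subtree Z X n v).mono (iSup₂_le fun w _ => hM.nodeSigma_le w) le_rfl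

omit [IsProbabilityMeasure P] in
theorem indep_biSup (hM : IsRunoffModel P α β Z X) {S T : Set (List ℕ)} (h : Disjoint S T) :
    Indep (⨆ w ∈ S, nodeSigma Z X w) (⨆ w ∈ T, nodeSigma Z X w) P :=
  indep_iSup_of_disjoint hM.nodeSigma_le hM.indep_nodes.iIndep h

omit [IsProbabilityMeasure P] in
theorem indepFun_children (hM : IsRunoffModel P α β Z X) (n : ℕ) (v : List ℕ) :
    IndepFun (runoffVar Z X n (v ++ [0])) (runoffVar Z X n (v ++ [1])) P := by
  -- Two prefixes of equal length of the same list coincide, so no node descends from both siblings.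
  have hd : Disjoint {w : List ℕ | v ++ [0] <+: w} {w : List ℕ | v ++ [1] <+: w} := by
    rw [Set.disjoint_left]
    intro w h0 h1
    have := (List.prefix_of_prefix_length_le h0 h1 (by simp)).eq_of_length (by simp)
    simp at this
  rw [IndepFun_iff_Indep]
  exact indep_of_indep_of_le_left (indep_of_indep_of_le_right (hM.indep_biSup hd)
    (measurable_integerRunoff_subtree Z X n (v ++ [1])).comap_le)
    (measurable_integerRunoff_subtree Z X n (v ++ [0])).comap_le

omit [IsProbabilityMeasure P] in
theorem indepFun_node_children (hM : IsRunoffModel P α β Z X) (n : ℕ) (v : List ℕ) :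
    IndepFun (fun ω => (Z v ω, X v ω))
      (fun ω => (runoffVar Z X n (v ++ [0]) ω, runoffVar Z X n (v ++ [1]) ω)) P := by
  have hd : Disjoint ({v} : Set (List ℕ))
      ({w : List ℕ | v ++ [0] <+: w} ∪ {w : List ℕ | v ++ [1] <+: w}) := by
    rw [Set.disjoint_singleton_left]
    rintro (h | h) <;> simpa using h.length_le
  have hm : ∀ i, {w : List ℕ | v ++ [i] <+: w} ⊆
      {w : List ℕ | v ++ [0] <+: w} ∪ {w : List ℕ | v ++ [1] <+: w} →
      Measurable[⨆ w ∈ {w : List ℕ | v ++ [0] <+: w} ∪ {w : List ℕ | v ++ [1] <+: w},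
        nodeSigma Z X w] (runoffVar Z X n (v ++ [i])) := fun i hi =>
    (measurable_integerRunoff_subtree Z X n (v ++ [i])).mono (biSup_mono hi) le_rfl
  rw [IndepFun_iff_Indep]
  refine indep_of_indep_of_le_left (indep_of_indep_of_le_right (hM.indep_biSup hd) ?_) ?_
  · exact Measurable.comap_le
      ((hm 0 Set.subset_union_left).prodMk (hm 1 Set.subset_union_right))
  · exact le_iSup₂_of_le (f := fun w (_ : w ∈ ({v} : Set (List ℕ))) => nodeSigma Z X w) v
      (Set.mem_singleton v) le_rfl

omit [IsProbabilityMeasure P] in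
theorem real_offspring (hM : IsRunoffModel P α β Z X) (hβ0 : 0 < β) (hβ1 : β ≤ 1 / 2)
    (v : List ℕ) : P.real {ω | Z v ω = 0} = β * (1 - β) ∧
      P.real {ω | Z v ω = 1} = 1 - 2 * (β * (1 - β)) ∧ P.real {ω | Z v ω = 2} = β * (1 - β) := by
  have h : 0 ≤ β * (1 - β) := mul_nonneg hβ0.le (by linarith)
  simp only [measureReal_def, hM.offspring_zero, hM.offspring_one, hM.offspring_two]
  rw [ENNReal.toReal_ofReal h, ENNReal.toReal_ofReal (by positivity)]
  exact ⟨rfl, by ring, rfl⟩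

omit [IsProbabilityMeasure P] in
theorem real_contribution (hM : IsRunoffModel P α β Z X) (hα0 : 0 < α) (hα1 : α < 1)
    (v : List ℕ) : P.real {ω | X v ω = 1} = α ∧ P.real {ω | X v ω = -1} = 1 - α := by
  simp only [measureReal_def, hM.contribution_one, hM.contribution_neg_one]
  rw [ENNReal.toReal_ofReal hα0.le, ENNReal.toReal_ofReal (by linarith)]
  exact ⟨rfl, rfl⟩

theorem ae_offspring_lt (hM : IsRunoffModel P α β Z X) (hβ0 : 0 < β) (hβ1 : β ≤ 1 / 2)
    (v : List ℕ) : ∀ᵐ ω ∂P, Z v ω < 3 := by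
  have hm := hM.measurable_offspring v
  have hms : ∀ k, MeasurableSet {ω | Z v ω = k} := fun k => hm (measurableSet_singleton k)
  obtain ⟨h0, h1, h2⟩ := hM.real_offspring hβ0 hβ1 v
  have hset : {ω | Z v ω < 3} = {ω | Z v ω = 0} ∪ ({ω | Z v ω = 1} ∪ {ω | Z v ω = 2}) := by
    ext ω; simp only [Set.mem_ofPred_eq, Set.mem_union]; omega
  have hr : P.real {ω | Z v ω < 3} = 1 := by
    rw [hset, measureReal_union _ ((hms 1).union (hms 2)), measureReal_union _ (hms 2), h0, h1, h2]
    · ring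
    · rw [Set.disjoint_left]; intro ω; simp only [Set.mem_ofPred_eq]; omega
    · rw [Set.disjoint_left]; intro ω; simp only [Set.mem_ofPred_eq, Set.mem_union]; omega
  exact (mem_ae_iff_prob_eq_one (hm (measurableSet_Iio (a := 3)))).mpr
    ((ENNReal.toReal_eq_one_iff _).mp hr)

theorem ae_contribution (hM : IsRunoffModel P α β Z X) (hα0 : 0 < α) (hα1 : α < 1)
    (v : List ℕ) : ∀ᵐ ω ∂P, X v ω = 1 ∨ X v ω = -1 := by
  have hm := hM.measurable_contribution v
  have hms : ∀ k, MeasurableSet {ω | X v ω = k} := fun k => hm (measurableSet_singleton k)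
  obtain ⟨h1, h2⟩ := hM.real_contribution hα0 hα1 v
  have hr : P.real {ω | X v ω = 1 ∨ X v ω = -1} = 1 := by
    rw [Set.ofPred_or, measureReal_union _ (hms _), h1, h2]
    · ring
    · rw [Set.disjoint_left]; intro ω h h'
      simp only [Set.mem_ofPred_eq] at h h'; rw [h] at h'; norm_num at h'
  exact (mem_ae_iff_prob_eq_one ((hms 1).union (hms (-1)))).mpr
    ((ENNReal.toReal_eq_one_iff _).mp hr)

theorem integral_pow_step (hM : IsRunoffModel P α β Z X) (hα0 : 0 < α) (hα1 : α < 1)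
    (hβ0 : 0 < β) (hβ1 : β ≤ 1 / 2) {n : ℕ} (v : List ℕ) {t g g₀ : ℝ} (ht0 : 0 ≤ t) (ht1 : t ≤ 1)
    (hg : ∀ v, ∫ ω, t ^ runoffVar Z X n v ω ∂P = g)
    (hg₀ : ∀ v, ∫ ω, (0 : ℝ) ^ runoffVar Z X n v ω ∂P = g₀) :
    t * ∫ ω, t ^ runoffVar Z X (n + 1) v ω ∂P =
      (α * t ^ 2 + (1 - α)) * (g + β * (1 - β) * (1 - g) ^ 2) -
        (1 - α) * (1 - t) * (g₀ + β * (1 - β) * (1 - g₀) ^ 2) := by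
  obtain ⟨h0, h1, h2⟩ := hM.real_offspring hβ0 hβ1 v
  obtain ⟨k1, k2⟩ := hM.real_contribution hα0 hα1 v
  rw [← integral_pow_runoff_step (hM.measurable_offspring v) (hM.measurable_contribution v)
    (hM.measurable_runoffVar n (v ++ [0])) (hM.measurable_runoffVar n (v ++ [1]))
    (hM.indepFun_children n v) (hM.indep_offspring_contribution v) (hM.indepFun_node_children n v)
    h0 h1 h2 k1 k2 (hM.ae_offspring_lt hβ0 hβ1 v) (hM.ae_contribution hα0 hα1 v) ht0 ht1
    (hg _) (hg _) (hg₀ _) (hg₀ _)]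
  congr 1
  refine integral_congr_ae ?_
  filter_upwards [hM.ae_offspring_lt hβ0 hβ1 v] with ω hω
  have : ∑ i ∈ Finset.range (Z v ω), integerRunoff (fun v => Z v ω) (fun v => X v ω) n (v ++ [i]) =
      childSum (Z v ω) (runoffVar Z X n (v ++ [0]) ω, runoffVar Z X n (v ++ [1]) ω) := by
    generalize Z v ω = z at hω
    interval_cases z <;> simp [childSum, Finset.sum_range_succ]
  simp only [runoffVar, integerRunoff] at this ⊢
  rw [this]

theorem continuousOn_integral_pow {Y : Ω → ℕ} (hY : Measurable Y) :
    ContinuousOn (fun t : ℝ => ∫ ω, t ^ Y ω ∂P) (Set.Icc 0 1) := by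
  refine continuousOn_of_dominated (bound := fun _ => 1) ?_ ?_ (integrable_const _) ?_
  · exact fun t _ => ((measurable_of_countable (fun k : ℕ => t ^ k)).comp hY).aestronglyMeasurable
  · intro t ht
    refine Eventually.of_forall fun ω => ?_
    rw [Real.norm_eq_abs, abs_of_nonneg (pow_nonneg ht.1 _)]
    exact pow_le_one₀ ht.1 ht.2
  · exact Eventually.of_forall fun ω => (continuous_pow _).continuousOn

/-- The one-step identity has a right-hand side independent of the node, so equality of the
generating functions propagates by induction. -/
theorem integral_pow_runoffVar_eq (hM : IsRunoffModel P α β Z X) (hα0 : 0 < α) (hα1 : α < 1)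
    (hβ0 : 0 < β) (hβ1 : β ≤ 1 / 2) (n : ℕ) (v : List ℕ) {t : ℝ} (ht : t ∈ Set.Icc (0 : ℝ) 1) :
    ∫ ω, t ^ runoffVar Z X n v ω ∂P = ∫ ω, t ^ runoffVar Z X n [] ω ∂P := by
  induction n generalizing v t with
  | zero => simp [runoffVar, integerRunoff]
  | succ n ih =>
    have hpos : ∀ t ∈ Set.Ioc (0 : ℝ) 1, ∫ ω, t ^ runoffVar Z X (n + 1) v ω ∂P =
        ∫ ω, t ^ runoffVar Z X (n + 1) [] ω ∂P := by
      intro t ht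
      have h := fun v => hM.integral_pow_step hα0 hα1 hβ0 hβ1 (n := n) v ht.1.le ht.2
        (fun v => ih v ⟨ht.1.le, ht.2⟩) (fun v => ih v ⟨le_rfl, zero_le_one⟩)
      exact mul_left_cancel₀ ht.1.ne' ((h v).trans (h []).symm)
    -- At `t = 0` the factor `t` cannot be cancelled, yet the next step needs that value as `g₀`; it
    -- is recovered by continuity.
    have hc : Set.EqOn (fun t : ℝ => ∫ ω, t ^ runoffVar Z X (n + 1) v ω ∂P)
        (fun t : ℝ => ∫ ω, t ^ runoffVar Z X (n + 1) [] ω ∂P) (Set.Icc 0 1) := by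
      refine Set.EqOn.of_subset_closure (s := Set.Ioc (0 : ℝ) 1) hpos
        (continuousOn_integral_pow (hM.measurable_runoffVar _ _))
        (continuousOn_integral_pow (hM.measurable_runoffVar _ _)) Set.Ioc_subset_Icc_self ?_
      rw [closure_Ioc zero_ne_one]
    exact hc ht

/-- Expand `1 - t^m = (1-t) ∑_{k<m} t^k` and integrate. Working with tails lets the limit in `n` be
taken before `W` is known to be finite. -/
theorem one_sub_integral_pow {Y : Ω → ℕ} (hY : Measurable Y) {t : ℝ} (ht0 : 0 ≤ t) (ht1 : t < 1) :
    1 - ∫ ω, t ^ Y ω ∂P = (1 - t) * ∑' k : ℕ, P.real {ω | k < Y ω} * t ^ k := by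
  have hms : ∀ k, MeasurableSet {ω | k < Y ω} := fun k => hY measurableSet_Ioi
  have hpt : ∀ m : ℕ, 1 - t ^ m = (1 - t) * ∑' k : ℕ, (if k < m then t ^ k else 0) := by
    intro m
    rw [tsum_eq_sum (s := Finset.range m) (fun k hk => if_neg (by simpa using hk)),
      Finset.sum_congr rfl (fun k hk => if_pos (Finset.mem_range.mp hk)), mul_comm,
      geom_sum_mul_neg]
  have hs : ∀ k : ℕ, ∫ ω, (if k < Y ω then t ^ k else 0) ∂P = P.real {ω | k < Y ω} * t ^ k := by
    intro k
    have : (fun ω => if k < Y ω then t ^ k else 0) = {ω | k < Y ω}.indicator (fun _ => t ^ k) := by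
      ext ω; simp [Set.indicator]
    rw [this, integral_indicator_const _ (hms k), smul_eq_mul]
  have hb : ∀ k ω, ‖(if k < Y ω then t ^ k else 0)‖ ≤ t ^ k := by
    intro k ω
    split_ifs
    · rw [Real.norm_eq_abs, abs_of_nonneg (pow_nonneg ht0 _)]
    · simpa using pow_nonneg ht0 k
  have hm : ∀ k : ℕ, Measurable (fun ω => if k < Y ω then t ^ k else 0) := fun k =>
    Measurable.ite (hms k) measurable_const measurable_const
  have hi : ∀ k : ℕ, Integrable (fun ω => if k < Y ω then t ^ k else 0) P := fun k =>
    Integrable.of_bound (hm k).aestronglyMeasurable (t ^ k) (Eventually.of_forall (hb k))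
  have hsum : Summable fun k : ℕ => ∫ ω, ‖(if k < Y ω then t ^ k else 0)‖ ∂P := by
    refine Summable.of_nonneg_of_le (fun k => integral_nonneg fun _ => norm_nonneg _) (fun k => ?_)
      (summable_geometric_of_lt_one ht0 ht1)
    calc _ ≤ ∫ _, t ^ k ∂P := integral_mono (hi k).norm (integrable_const _) (hb k)
      _ = t ^ k := by simp
  have h1 : 1 - ∫ ω, t ^ Y ω ∂P = ∫ ω, (1 - t ^ Y ω) ∂P := by
    rw [integral_sub (integrable_const _)]
    · simp
    · refine Integrable.of_bound ((measurable_of_countable (fun k : ℕ => t ^ k)).comp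
        hY).aestronglyMeasurable 1 (Eventually.of_forall fun ω => ?_)
      rw [Real.norm_eq_abs, abs_of_nonneg (pow_nonneg ht0 _)]
      exact pow_le_one₀ ht0 ht1.le
  rw [h1]
  simp only [hpt, integral_const_mul]
  rw [← integral_tsum_of_summable_integral_norm hi hsum]
  simp only [hs]

/-- The tail of the limit of the integer-valued runoffs from the root. -/
noncomputable def _root_.runoffTail (P : Measure Ω) (Z : List ℕ → Ω → ℕ) (X : List ℕ → Ω → ℝ)
    (k : ℕ) : ℝ := P.real {ω | ∃ n, k < runoffVar Z X n [] ω}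

theorem _root_.runoffTail_antitone : Antitone (runoffTail P Z X) := by
  intro k l hkl
  exact measureReal_mono fun ω ⟨n, hn⟩ => ⟨n, hkl.trans_lt hn⟩

theorem tendsto_runoffTail (k : ℕ) :
    Tendsto (fun n => P.real {ω | k < runoffVar Z X n [] ω}) atTop (𝓝 (runoffTail P Z X k)) := by
  have h : Monotone fun n => {ω | k < runoffVar Z X n [] ω} :=
    monotone_nat_of_le_succ fun n ω hω => lt_of_lt_of_le hω (integerRunoff_le_succ _ _ n [])
  have := tendsto_measure_iUnion_atTop (μ := P) h
  rw [← Set.ofPred_exists] at this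
  exact (ENNReal.tendsto_toReal (measure_ne_top _ _)).comp this

/-- The functional equation for the generating function of the tail of the root runoff. -/
theorem runoffTail_equation (hM : IsRunoffModel P α β Z X) (hα0 : 0 < α) (hα1 : α < 1)
    (hβ0 : 0 < β) (hβ1 : β ≤ 1 / 2) {t u : ℝ} (ht0 : 0 ≤ t) (ht1 : t < 1)
    (hu : u = (1 - t) * ∑' k, runoffTail P Z X k * t ^ k) :
    t * (1 - u) = (α * t ^ 2 + (1 - α)) * (1 - u + β * (1 - β) * u ^ 2) -
      (1 - α) * (1 - t) * (1 - runoffTail P Z X 0 + β * (1 - β) * runoffTail P Z X 0 ^ 2) := by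
  have hlim : ∀ t : ℝ, 0 ≤ t → t < 1 → Tendsto (fun n => ∫ ω, t ^ runoffVar Z X n [] ω ∂P) atTop
      (𝓝 (1 - (1 - t) * ∑' k, runoffTail P Z X k * t ^ k)) := by
    intro t ht0 ht1
    have h := fun n => one_sub_integral_pow (P := P) (hM.measurable_runoffVar n []) ht0 ht1
    have h' : ∀ n, ∫ ω, t ^ runoffVar Z X n [] ω ∂P =
        1 - (1 - t) * ∑' k : ℕ, P.real {ω | k < runoffVar Z X n [] ω} * t ^ k := fun n => by
      rw [← h n]; ring
    simp only [h']
    refine tendsto_const_nhds.sub (Tendsto.const_mul _ ?_)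
    refine tendsto_tsum_of_dominated_convergence (bound := fun k => t ^ k)
      (summable_geometric_of_lt_one ht0 ht1) (fun k => (tendsto_runoffTail k).mul_const _) ?_
    refine Eventually.of_forall fun n k => ?_
    rw [Real.norm_eq_abs, abs_of_nonneg (mul_nonneg measureReal_nonneg (pow_nonneg ht0 _))]
    exact mul_le_of_le_one_left (pow_nonneg ht0 _) measureReal_le_one
  have hl := hlim t ht0 ht1
  rw [← hu] at hl
  have hl0 := hlim 0 le_rfl zero_lt_one
  have hz : ∑' k, runoffTail P Z X k * (0 : ℝ) ^ k = runoffTail P Z X 0 := by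
    rw [tsum_eq_single 0 (fun k hk => by simp [hk])]; simp
  rw [hz, sub_zero, one_mul] at hl0
  have hstep := fun n => hM.integral_pow_step hα0 hα1 hβ0 hβ1 (n := n) [] ht0 ht1.le
    (fun v => hM.integral_pow_runoffVar_eq hα0 hα1 hβ0 hβ1 n v ⟨ht0, ht1.le⟩)
    (fun v => hM.integral_pow_runoffVar_eq hα0 hα1 hβ0 hβ1 n v ⟨le_rfl, zero_le_one⟩)
  have hL := ((hl.comp (tendsto_add_atTop_nat 1)).const_mul t)
  have hF : ∀ {c : ℕ → ℝ} {a : ℝ}, Tendsto c atTop (𝓝 a) →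
      Tendsto (fun n => c n + β * (1 - β) * (1 - c n) ^ 2) atTop
        (𝓝 (a + β * (1 - β) * (1 - a) ^ 2)) := fun h =>
    h.add (((tendsto_const_nhds.sub h).pow 2).const_mul _)
  have hR := ((hF hl).const_mul (α * t ^ 2 + (1 - α))).sub
    ((hF hl0).const_mul ((1 - α) * (1 - t)))
  have := tendsto_nhds_unique (hL.congr fun n => hstep n) hR
  rw [this]
  ring

theorem ae_lt_rootRunoff_iff (hM : IsRunoffModel P α β Z X) (hα0 : 0 < α) (hα1 : α < 1) :
    ∀ᵐ ω ∂P, ∀ x : ℝ, 0 ≤ x →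
      (ENNReal.ofReal x < rootRunoff (fun v => Z v ω) (fun v => X v ω) ↔
        ∃ n, ⌊x⌋₊ < runoffVar Z X n [] ω) := by
  filter_upwards [ae_all_iff.mpr fun v => hM.ae_contribution hα0 hα1 v] with ω hω x hx
  have key : ∀ n, (ENNReal.ofReal x <
      ENNReal.ofReal (truncatedRunoff (fun v => Z v ω) (fun v => X v ω) n [])) ↔
      ⌊x⌋₊ < runoffVar Z X (n + 1) [] ω := by
    intro n
    rw [truncatedRunoff_eq_integerRunoff hω, Nat.floor_lt hx]
    exact ENNReal.ofReal_lt_ofReal_iff_of_nonneg hx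
  rw [rootRunoff, lt_iSup_iff]
  simp only [key]
  constructor
  · rintro ⟨n, hn⟩; exact ⟨n + 1, hn⟩
  · rintro ⟨n, hn⟩
    exact ⟨n, hn.trans_le (integerRunoff_le_succ _ _ n [])⟩

theorem measureReal_rootRunoff (hM : IsRunoffModel P α β Z X) (hα0 : 0 < α) (hα1 : α < 1)
    {x : ℝ} (hx : 0 ≤ x) :
    P.real {ω | ENNReal.ofReal x < rootRunoff (fun v => Z v ω) (fun v => X v ω)} =
      runoffTail P Z X ⌊x⌋₊ := by
  refine measureReal_congr ?_
  filter_upwards [hM.ae_lt_rootRunoff_iff hα0 hα1] with ω hω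
  exact propext (hω x hx)

/-- If the tail of the root runoff decays faster than every power, then all its moments are finite. -/
theorem lintegral_rootRunoff_rpow_lt_top (hM : IsRunoffModel P α β Z X) (hα0 : 0 < α) (hα1 : α < 1)
    (hsum : ∀ m : ℕ, Summable fun k : ℕ => ((k : ℝ) + 1) ^ m * runoffTail P Z X k)
    {r : ℝ} (hr : 0 < r) :
    ∫⁻ ω, rootRunoff (fun v => Z v ω) (fun v => X v ω) ^ r ∂P < ⊤ := by
  obtain ⟨m, hm⟩ := exists_nat_ge r
  have hms : ∀ k : ℕ, MeasurableSet {ω | ∃ n, k < runoffVar Z X n [] ω} := fun k => by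
    rw [Set.ofPred_exists]
    exact MeasurableSet.iUnion fun n => hM.measurable_runoffVar n [] measurableSet_Ioi
  -- For `0 < W < ∞` the single term `k = ⌈W⌉ - 1` already dominates `W^r`; for `W = ∞` all terms
  -- are present and they are unbounded.
  have hbound : ∀ᵐ ω ∂P, rootRunoff (fun v => Z v ω) (fun v => X v ω) ^ r ≤
      ∑' k : ℕ, {ω | ∃ n, k < runoffVar Z X n [] ω}.indicator
        (fun _ => ENNReal.ofReal (((k : ℝ) + 1) ^ m)) ω := by
    filter_upwards [hM.ae_lt_rootRunoff_iff hα0 hα1] with ω hω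
    generalize rootRunoff (fun v => Z v ω) (fun v => X v ω) = W at hω
    have hk : ∀ k : ℕ, (k : ENNReal) < W → {ω | ∃ n, k < runoffVar Z X n [] ω}.indicator
        (fun _ => ENNReal.ofReal (((k : ℝ) + 1) ^ m)) ω = ENNReal.ofReal (((k : ℝ) + 1) ^ m) := by
      intro k hk
      refine Set.indicator_of_mem ?_ _
      have := (hω k (Nat.cast_nonneg k)).mp (by simpa using hk)
      simpa using this
    have hterm : ∀ k : ℕ, (k : ENNReal) < W → ENNReal.ofReal (((k : ℝ) + 1) ^ m) ≤
        ∑' k : ℕ, {ω | ∃ n, k < runoffVar Z X n [] ω}.indicator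
          (fun _ => ENNReal.ofReal (((k : ℝ) + 1) ^ m)) ω := by
      intro k h
      rw [← hk k h]
      exact ENNReal.le_tsum k
    rcases eq_or_ne W ⊤ with hW | hW
    · have hm0 : m ≠ 0 := by
        rintro rfl; simp at hm; linarith
      refine le_of_le_of_eq le_top (Eq.symm ?_)
      refine ENNReal.eq_top_of_forall_nnreal_le fun q => ?_
      obtain ⟨k, hkq⟩ := exists_nat_ge (q : ℝ)
      refine le_trans ?_ (hterm k (by rw [hW]; exact ENNReal.natCast_lt_top k))
      rw [← ENNReal.ofReal_coe_nnreal]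
      refine ENNReal.ofReal_le_ofReal ?_
      have h1 : (1 : ℝ) ≤ k + 1 := by linarith [(Nat.cast_nonneg k : (0 : ℝ) ≤ k)]
      exact (by linarith : (q : ℝ) ≤ k + 1).trans (le_self_pow₀ h1 hm0)
    · lift W to NNReal using hW
      rcases eq_or_ne W 0 with h0 | h0
      · simp [h0, hr]
      · obtain ⟨k, hk1, hk2⟩ : ∃ k : ℕ, (k : NNReal) < W ∧ W ≤ k + 1 := by
          have hc : 0 < ⌈W⌉₊ := Nat.ceil_pos.mpr (pos_iff_ne_zero.mpr h0)
          refine ⟨⌈W⌉₊ - 1, ?_, ?_⟩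
          · exact Nat.lt_ceil.mp (by omega)
          · have := Nat.le_ceil W
            have h2 : ((⌈W⌉₊ - 1 : ℕ) : NNReal) + 1 = (⌈W⌉₊ : NNReal) := by
              exact_mod_cast Nat.sub_add_cancel hc
            rwa [h2]
        refine le_trans ?_ (hterm k (by exact_mod_cast hk1))
        have h1 : (1 : ℝ) ≤ k + 1 := by linarith [(Nat.cast_nonneg k : (0 : ℝ) ≤ k)]
        rw [← ENNReal.ofReal_coe_nnreal, ENNReal.ofReal_rpow_of_nonneg W.coe_nonneg hr.le]
        refine ENNReal.ofReal_le_ofReal ?_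
        calc (W : ℝ) ^ r ≤ ((k : ℝ) + 1) ^ r :=
              Real.rpow_le_rpow W.coe_nonneg (by exact_mod_cast hk2) hr.le
          _ ≤ ((k : ℝ) + 1) ^ (m : ℝ) := Real.rpow_le_rpow_of_exponent_le h1 hm
          _ = _ := Real.rpow_natCast _ _
  refine (lintegral_mono_ae hbound).trans_lt ?_
  rw [lintegral_tsum fun k => (measurable_const.indicator (hms k)).aemeasurable]
  have : ∀ k : ℕ, ∫⁻ ω, {ω | ∃ n, k < runoffVar Z X n [] ω}.indicator
        (fun _ => ENNReal.ofReal (((k : ℝ) + 1) ^ m)) ω ∂P =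
      ENNReal.ofReal (((k : ℝ) + 1) ^ m * runoffTail P Z X k) := by
    intro k
    rw [lintegral_indicator_const (hms k), ENNReal.ofReal_mul (by positivity), runoffTail,
      ofReal_measureReal]
  simp only [this]
  exact (hsum m).tsum_ofReal_lt_top

end IsRunoffModel
end Model

/-! ### Karamata's Tauberian theorem and the monotone density theorem. -/

section Karamata

/-- The normalised Abel sums of `a` tested against a function on the unit interval. -/
noncomputable def abelSum (a : ℕ → ℝ) (f : ℝ → ℝ) (t : ℝ) : ℝ :=
  √(1 - t) * ∑' n, a n * t ^ n * f (t ^ n)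

/-- The density of the limit functional of the Abel sums. -/
noncomputable def halfGammaWeight (s : ℝ) : ℝ := s ^ ((1 / 2 : ℝ) - 1) * Real.exp (-s)

/-- The limit functional of the Abel sums. -/
noncomputable def abelLimit (C : ℝ) (f : ℝ → ℝ) : ℝ :=
  C / √Real.pi * ∫ s in Set.Ioi (0 : ℝ), halfGammaWeight s * f (Real.exp (-s))

theorem integrableOn_halfGammaWeight : IntegrableOn halfGammaWeight (Set.Ioi 0) := by
  have := Real.GammaIntegral_convergent (s := 1 / 2) (by norm_num)
  refine this.congr_fun (fun s _ => ?_) measurableSet_Ioi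
  simp only [halfGammaWeight]; ring

theorem halfGammaWeight_nonneg {s : ℝ} (hs : 0 < s) : 0 ≤ halfGammaWeight s := by
  unfold halfGammaWeight; positivity

variable {a : ℕ → ℝ} {C : ℝ}

theorem summable_abel_mul (ha : ∀ n, 0 ≤ a n)
    (hs : ∀ t : ℝ, 0 ≤ t → t < 1 → Summable fun n => a n * t ^ n) {t : ℝ} (ht0 : 0 ≤ t)
    (ht1 : t < 1) {f : ℝ → ℝ} {B : ℝ} (hf : ∀ x ∈ Set.Icc (0 : ℝ) 1, |f x| ≤ B) :
    Summable fun n => a n * t ^ n * f (t ^ n) := by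
  refine Summable.of_norm_bounded ((hs t ht0 ht1).mul_right B) fun n => ?_
  have h0 := mul_nonneg (ha n) (pow_nonneg ht0 n)
  rw [Real.norm_eq_abs, abs_mul, abs_of_nonneg h0]
  exact mul_le_mul_of_nonneg_left (hf _ ⟨pow_nonneg ht0 n, pow_le_one₀ ht0 ht1.le⟩) h0

theorem abelSum_mono (ha : ∀ n, 0 ≤ a n)
    (hs : ∀ t : ℝ, 0 ≤ t → t < 1 → Summable fun n => a n * t ^ n) {t : ℝ} (ht0 : 0 ≤ t)
    (ht1 : t < 1) {f g : ℝ → ℝ} {B B' : ℝ} (hf : ∀ x ∈ Set.Icc (0 : ℝ) 1, |f x| ≤ B)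
    (hg : ∀ x ∈ Set.Icc (0 : ℝ) 1, |g x| ≤ B') (hfg : ∀ x ∈ Set.Icc (0 : ℝ) 1, f x ≤ g x) :
    abelSum a f t ≤ abelSum a g t := by
  refine mul_le_mul_of_nonneg_left ?_ (Real.sqrt_nonneg _)
  refine Summable.tsum_le_tsum (fun n => ?_) (summable_abel_mul ha hs ht0 ht1 hf)
    (summable_abel_mul ha hs ht0 ht1 hg)
  exact mul_le_mul_of_nonneg_left (hfg _ ⟨pow_nonneg ht0 n, pow_le_one₀ ht0 ht1.le⟩)
    (mul_nonneg (ha n) (pow_nonneg ht0 n))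

theorem abelLimit_pow (C : ℝ) (k : ℕ) : abelLimit C (fun x => x ^ k) = C / √(k + 1) := by
  have hk : (0 : ℝ) < k + 1 := by positivity
  have h := Real.integral_rpow_mul_exp_neg_mul_Ioi (a := 1 / 2) (r := k + 1) (by norm_num) hk
  have : ∀ s : ℝ, halfGammaWeight s * Real.exp (-s) ^ k =
      s ^ ((1 / 2 : ℝ) - 1) * Real.exp (-(((k : ℝ) + 1) * s)) := by
    intro s
    rw [halfGammaWeight, mul_assoc, ← Real.exp_nat_mul, ← Real.exp_add]
    congr 2; ring
  have hpi : √Real.pi ≠ 0 := (Real.sqrt_pos.mpr Real.pi_pos).ne'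
  simp only [abelLimit, this]
  rw [h, Real.Gamma_one_half_eq, ← Real.sqrt_eq_rpow, one_div, Real.sqrt_inv]
  field_simp

/-- Testing against `x^k` replaces `t` by `t^(k+1)` in the power series; the ratio `(1 - t^(k+1)) /
(1 - t)` tends to `k + 1`. -/
theorem tendsto_abelSum_pow
    (hlim : Tendsto (fun t : ℝ => √(1 - t) * ∑' n, a n * t ^ n) (𝓝[<] 1) (𝓝 C)) (k : ℕ) :
    Tendsto (abelSum a fun x => x ^ k) (𝓝[<] 1) (𝓝 (abelLimit C fun x => x ^ k)) := by
  have hIoo : ∀ᶠ t : ℝ in 𝓝[<] 1, t ∈ Set.Ioo (0 : ℝ) 1 := Ioo_mem_nhdsLT zero_lt_one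
  have hpow : Tendsto (fun t : ℝ => t ^ (k + 1)) (𝓝[<] 1) (𝓝[<] 1) := by
    refine tendsto_nhdsWithin_iff.mpr ⟨?_, ?_⟩
    · have : Tendsto (fun t : ℝ => t ^ (k + 1)) (𝓝 1) (𝓝 (1 ^ (k + 1))) :=
        (continuous_pow (k + 1)).tendsto 1
      rw [one_pow] at this
      exact this.mono_left nhdsWithin_le_nhds
    · filter_upwards [hIoo] with t ht
      exact pow_lt_one₀ ht.1.le ht.2 (Nat.succ_ne_zero k)
  have hg : Tendsto (fun t : ℝ => √(∑ i ∈ Finset.range (k + 1), t ^ i)) (𝓝[<] 1)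
      (𝓝 √((k : ℝ) + 1)) := by
    have : Continuous fun t : ℝ => √(∑ i ∈ Finset.range (k + 1), t ^ i) := by fun_prop
    have h := (this.tendsto 1).mono_left (nhdsWithin_le_nhds (s := Set.Iio 1))
    simpa using h
  have hpos : √((k : ℝ) + 1) ≠ 0 := (Real.sqrt_pos.mpr (by positivity)).ne'
  rw [abelLimit_pow]
  refine ((hlim.comp hpow).div hg hpos).congr' ?_
  filter_upwards [hIoo] with t ht
  have hgp : 0 < ∑ i ∈ Finset.range (k + 1), t ^ i :=
    Finset.sum_pos (fun i _ => pow_pos ht.1 i) ⟨0, by simp⟩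
  have e : 1 - t ^ (k + 1) = (1 - t) * ∑ i ∈ Finset.range (k + 1), t ^ i := by
    rw [mul_comm, geom_sum_mul_neg]
  simp only [Pi.div_apply, Function.comp_apply, abelSum]
  rw [e, Real.sqrt_mul (by linarith [ht.2])]
  have : ∀ n, a n * (t ^ (k + 1)) ^ n = a n * t ^ n * (t ^ n) ^ k := fun n => by ring
  simp only [this]
  field_simp [(Real.sqrt_pos.mpr hgp).ne']

theorem tendsto_abelSum_polynomial (ha : ∀ n, 0 ≤ a n)
    (hs : ∀ t : ℝ, 0 ≤ t → t < 1 → Summable fun n => a n * t ^ n)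
    (hlim : Tendsto (fun t : ℝ => √(1 - t) * ∑' n, a n * t ^ n) (𝓝[<] 1) (𝓝 C))
    (p : Polynomial ℝ) :
    Tendsto (abelSum a fun x => p.eval x) (𝓝[<] 1) (𝓝 (abelLimit C fun x => p.eval x)) := by
  have hIoo : ∀ᶠ t : ℝ in 𝓝[<] 1, t ∈ Set.Ioo (0 : ℝ) 1 := Ioo_mem_nhdsLT zero_lt_one
  have hL : (abelLimit C fun x => p.eval x) =
      ∑ i ∈ Finset.range (p.natDegree + 1), p.coeff i * abelLimit C fun x => x ^ i := by
    have hi : ∀ i ∈ Finset.range (p.natDegree + 1), Integrable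
        (fun s => p.coeff i * (halfGammaWeight s * Real.exp (-s) ^ i))
        (volume.restrict (Set.Ioi (0 : ℝ))) := by
      intro i _
      refine Integrable.const_mul ?_ _
      refine Integrable.mul_bdd (c := 1) integrableOn_halfGammaWeight (by fun_prop) ?_
      refine (ae_restrict_iff' measurableSet_Ioi).mpr (Eventually.of_forall fun s hs => ?_)
      rw [Real.norm_eq_abs, abs_of_nonneg (by positivity)]
      exact pow_le_one₀ (Real.exp_pos _).le (Real.exp_le_one_iff.mpr (by simpa using le_of_lt hs))
    simp only [abelLimit]
    have : ∀ s, halfGammaWeight s * p.eval (Real.exp (-s)) =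
        ∑ i ∈ Finset.range (p.natDegree + 1),
          p.coeff i * (halfGammaWeight s * Real.exp (-s) ^ i) := by
      intro s
      rw [Polynomial.eval_eq_sum_range, Finset.mul_sum]
      exact Finset.sum_congr rfl fun i _ => by ring
    simp only [this]
    rw [integral_finsetSum _ hi, Finset.mul_sum]
    refine Finset.sum_congr rfl fun i _ => ?_
    rw [integral_const_mul]; ring
  rw [hL]
  refine (tendsto_finsetSum (Finset.range (p.natDegree + 1)) fun i _ =>
    (tendsto_abelSum_pow hlim i).const_mul (p.coeff i)).congr' ?_
  filter_upwards [hIoo] with t ht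
  have hsum : ∀ i ∈ Finset.range (p.natDegree + 1),
      Summable fun n => p.coeff i * (a n * t ^ n * (t ^ n) ^ i) := fun i _ =>
    (summable_abel_mul ha hs ht.1.le ht.2 (f := fun x => x ^ i) (B := 1) fun x hx => by
      rw [abs_of_nonneg (pow_nonneg hx.1 i)]; exact pow_le_one₀ hx.1 hx.2).mul_left _
  have : ∀ n, a n * t ^ n * p.eval (t ^ n) =
      ∑ i ∈ Finset.range (p.natDegree + 1), p.coeff i * (a n * t ^ n * (t ^ n) ^ i) := by
    intro n
    rw [Polynomial.eval_eq_sum_range, Finset.mul_sum]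
    exact Finset.sum_congr rfl fun i _ => by ring
  simp only [abelSum, this]
  rw [Summable.tsum_finsetSum hsum, Finset.mul_sum]
  refine Finset.sum_congr rfl fun i _ => ?_
  rw [tsum_mul_left]; ring

theorem integrableOn_halfGammaWeight_mul {f : ℝ → ℝ} {B : ℝ}
    (hm : Measurable f) (hf : ∀ x ∈ Set.Icc (0 : ℝ) 1, |f x| ≤ B) :
    IntegrableOn (fun s => halfGammaWeight s * f (Real.exp (-s))) (Set.Ioi 0) := by
  refine Integrable.mul_bdd (c := B) integrableOn_halfGammaWeight
    (hm.comp (by fun_prop)).aestronglyMeasurable ?_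
  refine (ae_restrict_iff' measurableSet_Ioi).mpr (Eventually.of_forall fun s hs => ?_)
  exact hf _ ⟨(Real.exp_pos _).le, Real.exp_le_one_iff.mpr (by simpa using le_of_lt hs)⟩

theorem abelLimit_mono (hC : 0 ≤ C) {f g : ℝ → ℝ} {B B' : ℝ} (hfm : Measurable f)
    (hgm : Measurable g) (hf : ∀ x ∈ Set.Icc (0 : ℝ) 1, |f x| ≤ B)
    (hg : ∀ x ∈ Set.Icc (0 : ℝ) 1, |g x| ≤ B') (hfg : ∀ x ∈ Set.Icc (0 : ℝ) 1, f x ≤ g x) :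
    abelLimit C f ≤ abelLimit C g := by
  refine mul_le_mul_of_nonneg_left ?_ (by positivity)
  refine setIntegral_mono_on (integrableOn_halfGammaWeight_mul hfm hf)
    (integrableOn_halfGammaWeight_mul hgm hg) measurableSet_Ioi fun s hs => ?_
  exact mul_le_mul_of_nonneg_left (hfg _ ⟨(Real.exp_pos _).le,
    Real.exp_le_one_iff.mpr (by simpa using le_of_lt hs)⟩) (halfGammaWeight_nonneg hs)

theorem tendsto_of_sandwich {F : ℝ → ℝ} {l : Filter ℝ} {c : ℝ}
    (h : ∀ ε > 0, ∃ (U V : ℝ → ℝ) (u v : ℝ), Tendsto U l (𝓝 u) ∧ Tendsto V l (𝓝 v) ∧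
      (∀ᶠ t in l, U t ≤ F t) ∧ (∀ᶠ t in l, F t ≤ V t) ∧ c - ε < u ∧ v < c + ε) :
    Tendsto F l (𝓝 c) := by
  refine tendsto_order.2 ⟨fun b hb => ?_, fun b hb => ?_⟩
  · obtain ⟨U, V, u, v, hU, -, hUF, -, hu, -⟩ := h (c - b) (by linarith)
    filter_upwards [hUF, (tendsto_order.1 hU).1 b (by linarith)] with t h1 h2
    linarith
  · obtain ⟨U, V, u, v, -, hV, -, hFV, -, hv⟩ := h (b - c) (by linarith)
    filter_upwards [hFV, (tendsto_order.1 hV).2 b (by linarith)] with t h1 h2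
    linarith

/-- By Weierstrass, `f` lies between two polynomials differing by a small constant; nonnegativity of
`a` makes the Abel sums monotone in the test function. -/
theorem tendsto_abelSum_continuous (ha : ∀ n, 0 ≤ a n) (hC : 0 ≤ C)
    (hs : ∀ t : ℝ, 0 ≤ t → t < 1 → Summable fun n => a n * t ^ n)
    (hlim : Tendsto (fun t : ℝ => √(1 - t) * ∑' n, a n * t ^ n) (𝓝[<] 1) (𝓝 C))
    {f : ℝ → ℝ} (hf : Continuous f) :
    Tendsto (abelSum a f) (𝓝[<] 1) (𝓝 (abelLimit C f)) := by
  have hIoo : ∀ᶠ t : ℝ in 𝓝[<] 1, t ∈ Set.Ioo (0 : ℝ) 1 := Ioo_mem_nhdsLT zero_lt_one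
  have hbdd : ∀ g : ℝ → ℝ, Continuous g → ∃ B, ∀ x ∈ Set.Icc (0 : ℝ) 1, |g x| ≤ B := fun g hg =>
    isCompact_Icc.exists_bound_of_continuousOn hg.continuousOn
  obtain ⟨B, hB⟩ := hbdd f hf
  refine tendsto_of_sandwich fun ε hε => ?_
  -- The limits for `p ± δ` differ by `2 * δ * C`; the `C + 1` in the witness allows `C = 0`.
  obtain ⟨δ, hδ, hδε⟩ : ∃ δ > 0, 2 * δ * C < ε :=
    ⟨ε / (2 * (C + 1)), by positivity, by
      rw [show 2 * (ε / (2 * (C + 1))) * C = ε * (C / (C + 1)) by field_simp]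
      exact mul_lt_of_lt_one_right hε ((div_lt_one (by linarith)).mpr (by linarith))⟩
  obtain ⟨p, hp⟩ := exists_polynomial_near_of_continuousOn 0 1 f hf.continuousOn δ hδ
  let p₁ : Polynomial ℝ := p - Polynomial.C δ
  let p₂ : Polynomial ℝ := p + Polynomial.C δ
  have hlo : ∀ x ∈ Set.Icc (0 : ℝ) 1, p₁.eval x ≤ f x := fun x hx => by
    have := abs_lt.mp (hp x hx)
    simp only [p₁, Polynomial.eval_sub, Polynomial.eval_C]; linarith
  have hhi : ∀ x ∈ Set.Icc (0 : ℝ) 1, f x ≤ p₂.eval x := fun x hx => by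
    have := abs_lt.mp (hp x hx)
    simp only [p₂, Polynomial.eval_add, Polynomial.eval_C]; linarith
  obtain ⟨B₁, hB₁⟩ := hbdd _ p₁.continuous
  obtain ⟨B₂, hB₂⟩ := hbdd _ p₂.continuous
  have hdiff : (abelLimit C fun x => p₂.eval x) = (abelLimit C fun x => p₁.eval x) + 2 * δ * C := by
    have hone : abelLimit C (fun x => x ^ 0) = C := by rw [abelLimit_pow]; simp
    have h1 : ∀ s, halfGammaWeight s * p₂.eval (Real.exp (-s)) =
        halfGammaWeight s * p₁.eval (Real.exp (-s)) +
          2 * δ * (halfGammaWeight s * Real.exp (-s) ^ 0) := by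
      intro s
      simp only [p₁, p₂, Polynomial.eval_add, Polynomial.eval_sub, Polynomial.eval_C, pow_zero]
      ring
    simp only [abelLimit, h1] at hone ⊢
    rw [integral_add (integrableOn_halfGammaWeight_mul p₁.continuous.measurable hB₁)
      ((by simpa using integrableOn_halfGammaWeight : IntegrableOn
        (fun s => halfGammaWeight s * Real.exp (-s) ^ 0) (Set.Ioi 0)).const_mul _),
      integral_const_mul, mul_add]
    linear_combination 2 * δ * hone
  have hm1 := abelLimit_mono hC p₁.continuous.measurable hf.measurable hB₁ hB hlo
  have hm2 := abelLimit_mono hC hf.measurable p₂.continuous.measurable hB hB₂ hhi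
  refine ⟨_, _, _, _, tendsto_abelSum_polynomial ha hs hlim p₁,
    tendsto_abelSum_polynomial ha hs hlim p₂, ?_, ?_, ?_, ?_⟩
  · filter_upwards [hIoo] with t ht using abelSum_mono ha hs ht.1.le ht.2 hB₁ hB hlo
  · filter_upwards [hIoo] with t ht using abelSum_mono ha hs ht.1.le ht.2 hB hB₂ hhi
  · linarith
  · linarith

/-- The test function which turns Abel sums into partial sums. -/
noncomputable def cutoff (x : ℝ) : ℝ := if Real.exp (-1) ≤ x then x⁻¹ else 0

/-- A continuous function close to the cutoff, with a ramp of slope `m` starting at height `c`. -/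
noncomputable def rampCutoff (c : ℝ) (m : ℕ) (x : ℝ) : ℝ :=
  (max x (Real.exp (-1)))⁻¹ * max 0 (min 1 (c + m * (x - Real.exp (-1))))

theorem continuous_rampCutoff (c : ℝ) (m : ℕ) : Continuous (rampCutoff c m) := by
  have : ∀ x : ℝ, max x (Real.exp (-1)) ≠ 0 := fun x =>
    (lt_of_lt_of_le (Real.exp_pos _) (le_max_right _ _)).ne'
  unfold rampCutoff
  fun_prop (disch := assumption)

theorem abs_rampCutoff_le (c : ℝ) (m : ℕ) (x : ℝ) : |rampCutoff c m x| ≤ Real.exp 1 := by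
  have h1 : 0 < max x (Real.exp (-1)) := lt_of_lt_of_le (Real.exp_pos _) (le_max_right _ _)
  have h2 : (max x (Real.exp (-1)))⁻¹ ≤ Real.exp 1 := by
    rw [inv_le_comm₀ h1 (Real.exp_pos _), ← Real.exp_neg]; exact le_max_right _ _
  rw [rampCutoff, abs_of_nonneg (mul_nonneg (inv_nonneg.mpr h1.le) (le_max_left _ _))]
  exact (mul_le_of_le_one_right (inv_nonneg.mpr h1.le)
    (max_le zero_le_one (min_le_left _ _))).trans h2

theorem cutoff_le_rampCutoff (m : ℕ) (x : ℝ) : cutoff x ≤ rampCutoff 1 m x := by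
  unfold cutoff rampCutoff
  split_ifs with h
  · have : (0 : ℝ) ≤ m * (x - Real.exp (-1)) := mul_nonneg (Nat.cast_nonneg m) (by linarith)
    rw [max_eq_left h, min_eq_left (by linarith), max_eq_right zero_le_one, mul_one]
  · exact mul_nonneg (inv_nonneg.mpr ((Real.exp_pos _).le.trans (le_max_right _ _)))
      (le_max_left _ _)

theorem rampCutoff_le_cutoff (m : ℕ) (x : ℝ) : rampCutoff 0 m x ≤ cutoff x := by
  unfold cutoff rampCutoff
  split_ifs with h
  · rw [max_eq_left h]
    exact mul_le_of_le_one_right (inv_nonneg.mpr ((Real.exp_pos _).le.trans h))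
      (max_le zero_le_one (min_le_left _ _))
  · have : (m : ℝ) * (x - Real.exp (-1)) ≤ 0 :=
      mul_nonpos_of_nonneg_of_nonpos (Nat.cast_nonneg m) (by linarith)
    rw [max_eq_left ((min_le_right _ _).trans (by linarith)), mul_zero]

theorem abs_cutoff_le (x : ℝ) : |cutoff x| ≤ Real.exp 1 := by
  unfold cutoff
  split_ifs with h
  · have hx := (Real.exp_pos (-1)).trans_le h
    rw [abs_of_pos (inv_pos.mpr hx), inv_le_comm₀ hx (Real.exp_pos _), ← Real.exp_neg]
    exact h
  · simpa using (Real.exp_pos 1).le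

theorem tendsto_rampCutoff (c : ℝ) {x : ℝ} (hx : x ≠ Real.exp (-1)) :
    Tendsto (fun m => rampCutoff c m x) atTop (𝓝 (cutoff x)) := by
  refine tendsto_const_nhds.congr' ?_
  unfold cutoff rampCutoff
  rcases lt_or_gt_of_ne hx with h | h
  · have ht : Tendsto (fun m : ℕ => c + m * (x - Real.exp (-1))) atTop atBot :=
      tendsto_atBot_add_const_left _ _
        (tendsto_natCast_atTop_atTop.atTop_mul_const_of_neg (by linarith))
    filter_upwards [ht.eventually_le_atBot 0] with m hm
    rw [if_neg (by linarith), max_eq_left ((min_le_right _ _).trans hm), mul_zero]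
  · have ht : Tendsto (fun m : ℕ => c + m * (x - Real.exp (-1))) atTop atTop :=
      tendsto_atTop_add_const_left _ _
        (tendsto_natCast_atTop_atTop.atTop_mul_const (by linarith))
    filter_upwards [ht.eventually_ge_atTop 1] with m hm
    rw [if_pos h.le, min_eq_left hm, max_eq_right zero_le_one, max_eq_left h.le, mul_one]

/-- The ramps converge to the cutoff except at its jump, which corresponds to the null set `s = 1`.
Hence `c = 0` and `c = 1` bound the discontinuous cutoff from below and above with the same limit.
-/
theorem tendsto_abelLimit_rampCutoff (C c : ℝ) :
    Tendsto (fun m => abelLimit C (rampCutoff c m)) atTop (𝓝 (abelLimit C cutoff)) := by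
  refine Tendsto.const_mul _ ?_
  refine tendsto_integral_of_dominated_convergence (fun s => |halfGammaWeight s| * Real.exp 1)
    (fun m => (integrableOn_halfGammaWeight_mul (continuous_rampCutoff c m).measurable
      fun x _ => abs_rampCutoff_le c m x).aestronglyMeasurable)
    (integrableOn_halfGammaWeight.abs.mul_const _) ?_ ?_
  · refine fun m => Eventually.of_forall fun s => ?_
    rw [Real.norm_eq_abs, abs_mul]
    exact mul_le_mul_of_nonneg_left (abs_rampCutoff_le _ _ _) (abs_nonneg _)
  · have h1 : ∀ᵐ s : ℝ ∂(volume.restrict (Set.Ioi 0)), s ≠ 1 :=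
      ae_restrict_of_ae (measure_eq_zero_iff_ae_notMem.mp (measure_singleton (1 : ℝ)))
    filter_upwards [h1] with s hs
    refine Tendsto.const_mul _ (tendsto_rampCutoff c fun h => hs ?_)
    have := Real.exp_injective h
    linarith

theorem tendsto_abelSum_cutoff (ha : ∀ n, 0 ≤ a n) (hC : 0 ≤ C)
    (hs : ∀ t : ℝ, 0 ≤ t → t < 1 → Summable fun n => a n * t ^ n)
    (hlim : Tendsto (fun t : ℝ => √(1 - t) * ∑' n, a n * t ^ n) (𝓝[<] 1) (𝓝 C)) :
    Tendsto (abelSum a cutoff) (𝓝[<] 1) (𝓝 (abelLimit C cutoff)) := by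
  have hIoo : ∀ᶠ t : ℝ in 𝓝[<] 1, t ∈ Set.Ioo (0 : ℝ) 1 := Ioo_mem_nhdsLT zero_lt_one
  refine tendsto_of_sandwich fun ε hε => ?_
  obtain ⟨m, hm⟩ := ((tendsto_order.1 (tendsto_abelLimit_rampCutoff C 0)).1
    (abelLimit C cutoff - ε) (by linarith)).exists
  obtain ⟨m', hm'⟩ := ((tendsto_order.1 (tendsto_abelLimit_rampCutoff C 1)).2
    (abelLimit C cutoff + ε) (by linarith)).exists
  refine ⟨_, _, _, _, tendsto_abelSum_continuous ha hC hs hlim (continuous_rampCutoff 0 m),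
    tendsto_abelSum_continuous ha hC hs hlim (continuous_rampCutoff 1 m'), ?_, ?_, hm, hm'⟩
  · filter_upwards [hIoo] with t ht using abelSum_mono ha hs ht.1.le ht.2
      (fun x _ => abs_rampCutoff_le 0 m x) (fun x _ => abs_cutoff_le x)
      fun x _ => rampCutoff_le_cutoff m x
  · filter_upwards [hIoo] with t ht using abelSum_mono ha hs ht.1.le ht.2
      (fun x _ => abs_cutoff_le x) (fun x _ => abs_rampCutoff_le 1 m' x)
      fun x _ => cutoff_le_rampCutoff m' x

/-- The cutoff removes `s > 1` and cancels `exp (-s)` below, leaving `∫₀¹ s^(-1/2) ds = 2`. -/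
theorem abelLimit_cutoff (C : ℝ) : abelLimit C cutoff = 2 * C / √Real.pi := by
  have h : ∫ s in Set.Ioi (0 : ℝ), halfGammaWeight s * cutoff (Real.exp (-s)) =
      ∫ s in Set.Ioc (0 : ℝ) 1, s ^ ((1 / 2 : ℝ) - 1) := by
    rw [← Set.Ioc_union_Ioi_eq_Ioi (zero_le_one (α := ℝ)), setIntegral_union]
    · have h2 : ∫ s in Set.Ioi (1 : ℝ), halfGammaWeight s * cutoff (Real.exp (-s)) = 0 := by
        refine setIntegral_eq_zero_of_forall_eq_zero fun s hs => ?_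
        rw [cutoff, if_neg, mul_zero]
        rw [not_le]; exact Real.exp_lt_exp.mpr (by simpa using hs)
      rw [h2, add_zero]
      refine setIntegral_congr_fun measurableSet_Ioc fun s hs => ?_
      simp only [cutoff, halfGammaWeight]
      rw [if_pos (Real.exp_le_exp.mpr (by linarith [hs.2])), mul_assoc,
        mul_inv_cancel₀ (Real.exp_pos _).ne', mul_one]
    · exact Set.Ioc_disjoint_Ioi_same
    · exact measurableSet_Ioi
    · refine (integrableOn_halfGammaWeight_mul ?_ fun x _ => abs_cutoff_le x).mono_set
        Set.Ioc_subset_Ioi_self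
      exact Measurable.ite measurableSet_Ici measurable_inv measurable_const
    · refine (integrableOn_halfGammaWeight_mul ?_ fun x _ => abs_cutoff_le x).mono_set
        (Set.Ioi_subset_Ioi zero_le_one)
      exact Measurable.ite measurableSet_Ici measurable_inv measurable_const
  rw [abelLimit, h, ← intervalIntegral.integral_of_le zero_le_one,
    integral_rpow (Or.inl (by norm_num))]
  norm_num
  ring

/-- Karamata's Tauberian theorem for the exponent `1 / 2`. -/
theorem tendsto_partialSum_of_tendsto_abel (ha : ∀ n, 0 ≤ a n) (hC : 0 ≤ C)
    (hs : ∀ t : ℝ, 0 ≤ t → t < 1 → Summable fun n => a n * t ^ n)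
    (hlim : Tendsto (fun t : ℝ => √(1 - t) * ∑' n, a n * t ^ n) (𝓝[<] 1) (𝓝 C)) :
    Tendsto (fun N : ℕ => (∑ n ∈ Finset.range (N + 1), a n) / √N) atTop
      (𝓝 (2 * C / √Real.pi)) := by
  have hinv : Tendsto (fun N : ℕ => -((N : ℝ)⁻¹)) atTop (𝓝[≠] 0) := by
    refine tendsto_nhdsWithin_iff.mpr ⟨?_, ?_⟩
    · simpa using (tendsto_inv_atTop_nhds_zero_nat (𝕜 := ℝ)).neg
    · filter_upwards [eventually_gt_atTop 0] with N hN
      have : (0 : ℝ) < N := by exact_mod_cast hN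
      simp [this.ne']
  -- At `t = exp (-1/N)` one has `t^n ≥ exp (-1)` exactly when `n ≤ N`, so the Abel sum of the
  -- cutoff is the partial sum up to `N`.
  have ht : Tendsto (fun N : ℕ => Real.exp (-((N : ℝ)⁻¹))) atTop (𝓝[<] 1) := by
    refine tendsto_nhdsWithin_iff.mpr ⟨?_, ?_⟩
    · simpa [Function.comp_def] using (Real.continuous_exp.tendsto 0).comp (hinv.mono_right nhdsWithin_le_nhds)
    · filter_upwards [eventually_gt_atTop 0] with N hN
      have : (0 : ℝ) < N := by exact_mod_cast hN
      simp [this]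
  have hslope : Tendsto (fun N : ℕ => √((1 - Real.exp (-((N : ℝ)⁻¹))) * N)) atTop (𝓝 1) := by
    have h := (hasDerivAt_iff_tendsto_slope.mp (Real.hasDerivAt_exp 0)).comp hinv
    rw [Real.exp_zero] at h
    have := (Real.continuous_sqrt.tendsto 1).comp h
    rw [Real.sqrt_one] at this
    refine this.congr fun N => ?_
    simp only [Function.comp_apply, slope, vsub_eq_sub, smul_eq_mul, Real.exp_zero, sub_zero]
    congr 1
    rw [inv_neg, inv_inv]; ring
  have h := ((tendsto_abelSum_cutoff ha hC hs hlim).comp ht).div hslope one_ne_zero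
  rw [abelLimit_cutoff, div_one] at h
  refine h.congr' ?_
  filter_upwards [eventually_gt_atTop 0] with N hN
  have hN' : (0 : ℝ) < N := by exact_mod_cast hN
  have hpos : 0 < 1 - Real.exp (-((N : ℝ)⁻¹)) := by simp [hN']
  have hpw : ∀ n : ℕ, Real.exp (-((N : ℝ)⁻¹)) ^ n = Real.exp (-(n / N)) := fun n => by
    rw [← Real.exp_nat_mul]; congr 1; ring
  have hsum : ∑' n, a n * Real.exp (-((N : ℝ)⁻¹)) ^ n * cutoff (Real.exp (-((N : ℝ)⁻¹)) ^ n) =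
      ∑ n ∈ Finset.range (N + 1), a n := by
    rw [tsum_eq_sum (s := Finset.range (N + 1))]
    · refine Finset.sum_congr rfl fun n hn => ?_
      have hnN : (n : ℝ) ≤ N := by exact_mod_cast Nat.lt_succ_iff.mp (Finset.mem_range.mp hn)
      rw [hpw, cutoff, if_pos, mul_assoc, mul_inv_cancel₀ (Real.exp_pos _).ne', mul_one]
      exact Real.exp_le_exp.mpr (neg_le_neg ((div_le_one hN').mpr hnN))
    · intro n hn
      have hnN : (N : ℝ) < n := by
        exact_mod_cast (by simpa [Nat.lt_succ_iff] using hn : N < n)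
      rw [hpw, cutoff, if_neg, mul_zero]
      rw [not_le]
      exact Real.exp_lt_exp.mpr (neg_lt_neg ((one_lt_div hN').mpr hnN))
  simp only [Function.comp_apply, abelSum, hsum, Pi.div_apply]
  rw [Real.sqrt_mul hpos.le, mul_div_mul_left _ _ (Real.sqrt_pos.mpr hpos).ne']

/-- The monotone density theorem for partial sums of order `√n`. -/
theorem tendsto_of_tendsto_partialSum_of_antitone {w : ℕ → ℝ} {c : ℝ} (j : ℕ) (hw : Antitone w)
    (hw0 : ∀ n, 0 ≤ w n)
    (hsum : Tendsto (fun N : ℕ => (∑ n ∈ Finset.range N, (n : ℝ) ^ j * w n) / √N) atTop (𝓝 c)) :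
    Tendsto (fun n : ℕ => (n : ℝ) ^ j * w n * √n) atTop (𝓝 (c / 2)) := by
  set A : ℕ → ℝ := fun N => ∑ n ∈ Finset.range N, (n : ℝ) ^ j * w n with hA
  replace hsum : Tendsto (fun N : ℕ => A N / √N) atTop (𝓝 c) := hsum
  have hratio : ∀ θ : ℝ, 0 < θ →
      Tendsto (fun n : ℕ => (⌊θ * n⌋₊ : ℝ) / n) atTop (𝓝 θ) := fun θ hθ =>
    (tendsto_nat_floor_mul_div_atTop hθ.le).comp tendsto_natCast_atTop_atTop
  have hfl : ∀ θ : ℝ, 0 < θ → Tendsto (fun n : ℕ => ⌊θ * n⌋₊) atTop atTop := fun θ hθ =>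
    tendsto_nat_floor_atTop.comp (tendsto_natCast_atTop_atTop.const_mul_atTop hθ)
  -- The increment of `A` between `n` and `⌊θ n⌋`, normalised by the length of the block and the
  -- change in the weight, brackets the quantity sought; its limit tends to `c / 2` as `θ → 1`.
  have hquot : ∀ θ : ℝ, 0 < θ → θ ≠ 1 → Tendsto (fun n : ℕ =>
      ((A n - A ⌊θ * n⌋₊) / √n) / ((1 - (⌊θ * n⌋₊ : ℝ) / n) * ((⌊θ * n⌋₊ : ℝ) / n) ^ j)) atTop
      (𝓝 (c / ((1 + √θ) * θ ^ j))) := by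
    intro θ hθ hθ1
    have h1 : Tendsto (fun n : ℕ => A ⌊θ * n⌋₊ / √n) atTop (𝓝 (c * √θ)) := by
      have hsq := (Real.continuous_sqrt.tendsto θ).comp (hratio θ hθ)
      refine ((hsum.comp (hfl θ hθ)).mul hsq).congr' ?_
      filter_upwards [(hfl θ hθ).eventually_gt_atTop 0] with n hn
      have : 0 < √(⌊θ * n⌋₊ : ℝ) := Real.sqrt_pos.mpr (by exact_mod_cast hn)
      simp only [Function.comp_apply]
      rw [Real.sqrt_div (Nat.cast_nonneg _)]
      field_simp
    have h2 := hsum.sub h1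
    have h3 := (tendsto_const_nhds (x := (1 : ℝ))).sub (hratio θ hθ)
    have h4 := h2.div (h3.mul ((hratio θ hθ).pow j))
      (mul_ne_zero (sub_ne_zero.mpr hθ1.symm) (pow_pos hθ j).ne')
    have e : (c - c * √θ) / ((1 - θ) * θ ^ j) = c / ((1 + √θ) * θ ^ j) := by
      have hs : √θ ^ 2 = θ := Real.sq_sqrt hθ.le
      have hp := (pow_pos hθ j).ne'
      have h5 : 1 + √θ ≠ 0 := by positivity
      rw [div_eq_div_iff (mul_ne_zero (sub_ne_zero.mpr hθ1.symm) hp) (mul_ne_zero h5 hp)]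
      linear_combination (-c * θ ^ j) * hs
    rw [e] at h4
    refine h4.congr fun n => ?_
    simp only [Pi.div_apply]
    rw [← sub_div]
  have hcont : Tendsto (fun θ : ℝ => c / ((1 + √θ) * θ ^ j)) (𝓝 1) (𝓝 (c / 2)) := by
    have : ContinuousAt (fun θ : ℝ => c / ((1 + √θ) * θ ^ j)) 1 := by
      refine continuousAt_const.div (by fun_prop) ?_
      simp
    have h := this.tendsto
    simpa [show (1 : ℝ) + 1 = 2 by norm_num] using h
  have hdiff : ∀ m n : ℕ, m ≤ n → A n - A m = ∑ k ∈ Finset.Ico m n, (k : ℝ) ^ j * w k :=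
    fun m n h => (Finset.sum_Ico_eq_sub _ h).symm
  refine tendsto_order.2 ⟨fun b hb => ?_, fun b hb => ?_⟩
  -- To the right of `n` both `w k ≤ w n` and `k^j ≤ m^j`, which bounds `w n` from below; the block
  -- to the left of `n` gives the upper bound.
  · obtain ⟨θ, hθ, hθ1⟩ : ∃ θ, b < c / ((1 + √θ) * θ ^ j) ∧ 1 < θ :=
      ((((tendsto_order.1 hcont).1 b hb).filter_mono nhdsWithin_le_nhds).and
        (self_mem_nhdsWithin (s := Set.Ioi (1 : ℝ)))).exists
    have hθ0 : 0 < θ := by linarith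
    filter_upwards [(tendsto_order.1 (hquot θ hθ0 hθ1.ne')).1 b hθ, eventually_gt_atTop 0,
      (tendsto_order.1 (hratio θ hθ0)).1 1 hθ1] with n hn hn0 hmn
    set m := ⌊θ * n⌋₊
    have hn' : (0 : ℝ) < n := by exact_mod_cast hn0
    have hlt : (n : ℝ) < m := by rwa [one_lt_div hn'] at hmn
    have hnm : n ≤ m := by exact_mod_cast hlt.le
    have hle : A m - A n ≤ (m - n) * ((m : ℝ) ^ j * w n) := by
      rw [hdiff n m hnm]
      calc _ ≤ ∑ k ∈ Finset.Ico n m, (m : ℝ) ^ j * w n := by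
            refine Finset.sum_le_sum fun k hk => ?_
            obtain ⟨h1, h2⟩ := Finset.mem_Ico.mp hk
            have : (k : ℝ) ≤ m := by exact_mod_cast h2.le
            exact mul_le_mul (by gcongr) (hw h1) (hw0 k) (by positivity)
        _ = _ := by rw [Finset.sum_const, Nat.card_Ico, nsmul_eq_mul, Nat.cast_sub hnm]
    refine hn.trans_le ?_
    have hs : 0 < √(n : ℝ) := Real.sqrt_pos.mpr hn'
    have hss : √(n : ℝ) * √n = n := Real.mul_self_sqrt hn'.le
    have hm0 : (0 : ℝ) < m := hn'.trans hlt
    have hden : 0 < ((m : ℝ) / n - 1) * ((m : ℝ) / n) ^ j :=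
      mul_pos (by linarith) (by positivity)
    rw [show (A n - A m) / √n / ((1 - (m : ℝ) / n) * ((m : ℝ) / n) ^ j) =
      (A m - A n) / √n / (((m : ℝ) / n - 1) * ((m : ℝ) / n) ^ j) by
        rw [← neg_div_neg_eq]; congr 1 <;> ring, div_le_iff₀ hden, div_le_iff₀ hs]
    refine hle.trans (le_of_eq ?_)
    rw [div_pow]
    field_simp
    linear_combination (-(w n) * (m - n)) * hss
  · obtain ⟨θ, hθ, hθ0, hθ1⟩ : ∃ θ, c / ((1 + √θ) * θ ^ j) < b ∧ 0 < θ ∧ θ < 1 := by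
      obtain ⟨θ, h1, h2⟩ := ((((tendsto_order.1 hcont).2 b hb).filter_mono nhdsWithin_le_nhds).and
        (Ioo_mem_nhdsLT (zero_lt_one (α := ℝ)))).exists
      exact ⟨θ, h1, h2.1, h2.2⟩
    filter_upwards [(tendsto_order.1 (hquot θ hθ0 hθ1.ne)).2 b hθ, eventually_gt_atTop 0,
      (tendsto_order.1 (hratio θ hθ0)).2 1 hθ1, (hfl θ hθ0).eventually_gt_atTop 0]
      with n hn hn0 hmn hm0
    set m := ⌊θ * n⌋₊
    have hn' : (0 : ℝ) < n := by exact_mod_cast hn0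
    have hm' : (0 : ℝ) < m := by exact_mod_cast hm0
    have hlt : (m : ℝ) < n := by rwa [div_lt_one hn'] at hmn
    have hnm : m ≤ n := by exact_mod_cast hlt.le
    have hle : (n - m) * ((m : ℝ) ^ j * w n) ≤ A n - A m := by
      rw [hdiff m n hnm]
      calc _ = ∑ k ∈ Finset.Ico m n, (m : ℝ) ^ j * w n := by
            rw [Finset.sum_const, Nat.card_Ico, nsmul_eq_mul, Nat.cast_sub hnm]
        _ ≤ _ := by
            refine Finset.sum_le_sum fun k hk => ?_
            obtain ⟨h1, h2⟩ := Finset.mem_Ico.mp hk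
            have : (m : ℝ) ≤ k := by exact_mod_cast h1
            exact mul_le_mul (by gcongr) (hw h2.le) (hw0 n) (by positivity)
    refine lt_of_le_of_lt ?_ hn
    have hs : 0 < √(n : ℝ) := Real.sqrt_pos.mpr hn'
    have hss : √(n : ℝ) * √n = n := Real.mul_self_sqrt hn'.le
    have hden : 0 < (1 - (m : ℝ) / n) * ((m : ℝ) / n) ^ j :=
      mul_pos (by linarith) (by positivity)
    rw [le_div_iff₀ hden, le_div_iff₀ hs]
    refine le_trans (le_of_eq ?_) hle
    rw [div_pow]
    field_simp
    linear_combination ((w n) * (n - m)) * hss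

end Karamata

/-! ### Power series with nonnegative coefficients at the boundary point `1`. -/

section PowerSeries

variable {a : ℕ → ℝ}

theorem summable_succ_mul_pow (hs : ∀ t : ℝ, 0 ≤ t → t < 1 → Summable fun n => a n * t ^ n)
    {r : ℝ} (hr0 : 0 ≤ r) (hr1 : r < 1) : Summable fun n : ℕ => (n : ℝ) * |a n| * r ^ (n - 1) := by
  obtain ⟨s, hrs, hs1⟩ := exists_between hr1
  have hs0 : 0 < s := hr0.trans_lt hrs
  -- Boundedness of `a n * s^n` at a radius `s > r` leaves a geometric factor `(r/s)^n` to absorb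
  -- `n`.
  obtain ⟨B, hB⟩ := (hs s hs0.le hs1).tendsto_atTop_zero.norm.bddAbove_range
  have hq : ‖r / s‖ < 1 := by
    rw [Real.norm_eq_abs, abs_of_nonneg (by positivity), div_lt_one hs0]; exact hrs
  rw [← summable_nat_add_iff 1]
  have hg := (summable_pow_mul_geometric_of_norm_lt_one 1 hq).add
    (summable_geometric_of_norm_lt_one hq)
  refine Summable.of_nonneg_of_le (fun n => by positivity) (fun n => ?_) (hg.mul_left (B / s))
  have hBn : |a (n + 1)| * s ^ (n + 1) ≤ B := by
    have := hB ⟨n + 1, rfl⟩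
    simpa [abs_of_pos hs0] using this
  have h1 : |a (n + 1)| ≤ B / s ^ (n + 1) := (le_div_iff₀ (by positivity)).mpr hBn
  calc ((n + 1 : ℕ) : ℝ) * |a (n + 1)| * r ^ (n + 1 - 1)
      ≤ ((n + 1 : ℕ) : ℝ) * (B / s ^ (n + 1)) * r ^ (n + 1 - 1) := by gcongr
    _ = B / s * ((n : ℝ) ^ 1 * (r / s) ^ n + (r / s) ^ n) := by
      push_cast
      rw [div_pow]
      field_simp
      ring

theorem hasDerivAt_tsum_mul_pow (hs : ∀ t : ℝ, 0 ≤ t → t < 1 → Summable fun n => a n * t ^ n)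
    {t : ℝ} (ht0 : 0 ≤ t) (ht1 : t < 1) :
    HasDerivAt (fun t => ∑' n, a n * t ^ n) (∑' n : ℕ, ((n : ℝ) + 1) * a (n + 1) * t ^ n) t := by
  obtain ⟨r, htr, hr1⟩ := exists_between ht1
  have hr0 : 0 < r := ht0.trans_lt htr
  have hsum := summable_succ_mul_pow hs hr0.le hr1
  have hd := hasDerivAt_tsum_of_isPreconnected (g := fun n t => a n * t ^ n)
    (g' := fun n t => a n * (n * t ^ (n - 1))) (t := Metric.ball (0 : ℝ) r) (y₀ := 0) (y := t)
    hsum Metric.isOpen_ball (convex_ball 0 r).isPreconnected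
    (fun n y _ => (hasDerivAt_pow n y).const_mul (a n))
    (fun n y hy => by
      rw [mem_ball_zero_iff] at hy
      rw [norm_mul, norm_mul, norm_pow, Real.norm_natCast, Real.norm_eq_abs, ← mul_assoc,
        mul_comm |a n|]
      gcongr)
    (Metric.mem_ball_self hr0) (hs 0 le_rfl zero_lt_one)
    (by rw [mem_ball_zero_iff, Real.norm_eq_abs, abs_of_nonneg ht0]; exact htr)
  convert! hd using 1
  have hsum' : Summable fun n : ℕ => a n * (n * t ^ (n - 1)) := by
    refine Summable.of_norm_bounded hsum fun n => ?_
    rw [norm_mul, norm_mul, norm_pow, Real.norm_natCast, Real.norm_eq_abs, Real.norm_eq_abs,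
      abs_of_nonneg ht0, ← mul_assoc, mul_comm |a n|]
    gcongr
  rw [hsum'.tsum_eq_zero_add]
  simp only [Nat.cast_zero, zero_mul, mul_zero, zero_add, Nat.add_sub_cancel]
  exact tsum_congr fun n => by push_cast; ring

theorem summable_succ_mul_succ_pow (hs : ∀ t : ℝ, 0 ≤ t → t < 1 → Summable fun n => a n * t ^ n)
    {t : ℝ} (ht0 : 0 ≤ t) (ht1 : t < 1) :
    Summable fun n : ℕ => ((n : ℝ) + 1) * a (n + 1) * t ^ n := by
  have h := (summable_nat_add_iff 1).mpr (summable_succ_mul_pow hs ht0 ht1)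
  refine Summable.of_norm_bounded h fun n => ?_
  rw [norm_mul, norm_mul, norm_pow, Real.norm_eq_abs, Real.norm_eq_abs, Real.norm_eq_abs,
    abs_of_nonneg ht0, abs_of_nonneg (by positivity : (0 : ℝ) ≤ n + 1)]
  simp

theorem summable_of_tsum_eventually_eq (ha : ∀ n, 0 ≤ a n)
    (hs : ∀ t : ℝ, 0 ≤ t → t < 1 → Summable fun n => a n * t ^ n) {ψ : ℝ → ℝ}
    (hψ : ContinuousAt ψ 1) (h : ∀ᶠ t in 𝓝[<] (1 : ℝ), ∑' n, a n * t ^ n = ψ t) : Summable a := by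
  refine summable_of_sum_range_le (c := ψ 1) ha fun N => ?_
  have h1 : Tendsto (fun t : ℝ => ∑ n ∈ Finset.range N, a n * t ^ n) (𝓝[<] 1)
      (𝓝 (∑ n ∈ Finset.range N, a n)) := by
    have : Continuous fun t : ℝ => ∑ n ∈ Finset.range N, a n * t ^ n := by fun_prop
    simpa using (this.tendsto 1).mono_left (nhdsWithin_le_nhds (s := Set.Iio 1))
  refine le_of_tendsto_of_tendsto h1 (hψ.tendsto.mono_left nhdsWithin_le_nhds) ?_
  filter_upwards [h, Ioo_mem_nhdsLT (zero_lt_one (α := ℝ))] with t ht ht'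
  rw [← ht]
  exact (hs t ht'.1.le ht'.2).sum_le_tsum _ fun n _ => mul_nonneg (ha n) (pow_nonneg ht'.1.le n)

/-- If a power series with non-negative coefficients extends analytically to `1`, then its
coefficients decay faster than every power. -/
theorem summable_pow_mul_of_analyticAt (k : ℕ) (ha : ∀ n, 0 ≤ a n)
    (hs : ∀ t : ℝ, 0 ≤ t → t < 1 → Summable fun n => a n * t ^ n) {ψ : ℝ → ℝ}
    (hψ : AnalyticAt ℝ ψ 1) (h : ∀ᶠ t in 𝓝[<] (1 : ℝ), ∑' n, a n * t ^ n = ψ t) :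
    Summable fun n : ℕ => ((n : ℝ) + 1) ^ k * a n := by
  induction k generalizing a ψ with
  | zero => simpa using summable_of_tsum_eventually_eq ha hs hψ.continuousAt h
  | succ k ih =>
    -- Shifting gives the series of `t * ∑ a n t^n`, whose derivative has coefficients `(n+1) * a
    -- n`: one more power of `n + 1`, with the same analyticity at `1`.
    let b : ℕ → ℝ := fun n => Nat.casesOn n 0 a
    have hb0 : b 0 = 0 := rfl
    have hb1 : ∀ n, b (n + 1) = a n := fun _ => rfl
    have hbs : ∀ t : ℝ, 0 ≤ t → t < 1 → Summable fun n => b n * t ^ n := by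
      intro t ht0 ht1
      rw [← summable_nat_add_iff 1]
      refine ((hs t ht0 ht1).mul_left t).congr fun n => ?_
      rw [hb1]; ring
    have hbt : ∀ t : ℝ, 0 ≤ t → t < 1 → ∑' n, b n * t ^ n = t * ∑' n, a n * t ^ n := by
      intro t ht0 ht1
      rw [(hbs t ht0 ht1).tsum_eq_zero_add, ← tsum_mul_left]
      rw [hb0, zero_mul, zero_add]
      exact tsum_congr fun n => by rw [hb1]; ring
    have := ih (a := fun n => ((n : ℝ) + 1) * a n) (ψ := deriv fun t => t * ψ t)
      (fun n => mul_nonneg (by positivity) (ha n))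
      (fun t ht0 ht1 => summable_succ_mul_succ_pow hbs ht0 ht1) (analyticAt_id.mul hψ).deriv ?_
    · refine this.congr fun n => by ring
    · have h' := eventually_eventually_nhdsWithin.mpr
        (h.and (Ioo_mem_nhdsLT (zero_lt_one (α := ℝ))))
      filter_upwards [h', Ioo_mem_nhdsLT (zero_lt_one (α := ℝ))] with t ht ht'
      rw [← (hasDerivAt_tsum_mul_pow hbs ht'.1.le ht'.2).deriv]
      refine EventuallyEq.deriv_eq ?_
      rw [nhdsWithin_eq_nhds.mpr (Iio_mem_nhds ht'.2)] at ht
      filter_upwards [ht] with s hs'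
      rw [hbt s hs'.2.1.le hs'.2.2, hs'.1]

end PowerSeries

/-! ### The discriminant of the functional equation and its zeros. -/

section Discriminant

/-- The quadratic factor in the denominator of `h`. -/
def quadFactor (α t : ℝ) : ℝ := α * t ^ 2 + (1 - α)

/-- The numerator of `h`. -/
def numeratorH (α p t : ℝ) : ℝ := t * (1 - α * (4 * p + t) - α ^ 2 * (1 - 4 * p) * (1 - t ^ 2))

/-- The cubic whose sign is that of the difference between a level and `h`. -/
def gapCubic (α p m t : ℝ) : ℝ := m * quadFactor α t - numeratorH α p t

/-- The quotient of `gapCubic` by `1 - t` at the level of `h 1`. -/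
def gapQuadratic (α p t : ℝ) : ℝ :=
  (1 - α) * (1 - α - 4 * p * α) - 2 * α * (1 - α) * t + α ^ 2 * (1 - 4 * p) * t ^ 2

variable {α p : ℝ}

theorem quadFactor_pos (hα0 : 0 < α) (hα1 : α < 1) (t : ℝ) : 0 < quadFactor α t := by
  have := mul_nonneg hα0.le (sq_nonneg t)
  unfold quadFactor; linarith

theorem gapCubic_at_one (α p t : ℝ) :
    gapCubic α p (numeratorH α p 1) t = (1 - t) * gapQuadratic α p t := by
  unfold gapCubic gapQuadratic numeratorH quadFactor; ring

theorem gapQuadratic_one (α p : ℝ) : gapQuadratic α p 1 = 1 - 4 * α * (1 + p) + 4 * α ^ 2 := by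
  unfold gapQuadratic; ring

theorem gapQuadratic_one_lt (hα0 : 0 < α) (hα : α ≤ 1 / 2) (hp : 0 < p) {t : ℝ}
    (ht0 : 0 ≤ t) (ht1 : t < 1) : gapQuadratic α p 1 < gapQuadratic α p t := by
  have h : gapQuadratic α p t - gapQuadratic α p 1 =
      (1 - t) * (α * (2 * (1 - α) - α * (1 - 4 * p) * (1 + t))) := by
    unfold gapQuadratic; ring
  have h1 : 0 < 2 * (1 - α) - α * (1 - 4 * p) * (1 + t) := by
    nlinarith [mul_pos hα0 hp, mul_nonneg (mul_pos hα0 hp).le ht0, mul_nonneg hα0.le ht0]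
  have := mul_pos (sub_pos.mpr ht1) (mul_pos hα0 h1)
  linarith

theorem hasDerivAt_gapCubic (α p m t : ℝ) : HasDerivAt (gapCubic α p m)
    (2 * α * (m + 1) * t - (1 - α) * (1 + α * (1 - 4 * p)) - 3 * α ^ 2 * (1 - 4 * p) * t ^ 2) t := by
  have e : gapCubic α p m = fun t => m * (1 - α) + (-((1 - α) * (1 + α * (1 - 4 * p)))) * t +
      α * (m + 1) * t ^ 2 + (-(α ^ 2 * (1 - 4 * p))) * t ^ 3 := by
    ext t; unfold gapCubic numeratorH quadFactor; ring
  rw [e]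
  have := (((hasDerivAt_id t).const_mul (-((1 - α) * (1 + α * (1 - 4 * p))))).const_add
    (m * (1 - α))).add ((hasDerivAt_pow 2 t).const_mul (α * (m + 1)))
  have := this.add ((hasDerivAt_pow 3 t).const_mul (-(α ^ 2 * (1 - 4 * p))))
  convert! this using 1
  simp; ring

/-- A nonnegative `gapCubic` has at most one zero in the unit interval. -/
theorem gapCubic_zero_unique (hα0 : 0 < α) (hα1 : α < 1) (hp : 0 < p) (hp4 : p ≤ 1 / 4)
    {m : ℝ} (hm : 0 < m) (hnn : ∀ t ∈ Set.Icc (0 : ℝ) 1, 0 ≤ gapCubic α p m t)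
    {s t : ℝ} (hs0 : 0 ≤ s) (hst : s < t) (ht1 : t ≤ 1) (hs : gapCubic α p m s = 0)
    (ht : gapCubic α p m t = 0) : False := by
  -- An interior zero is a minimum, hence a double zero.
  have hcrit : ∀ s : ℝ, 0 < s → s < 1 → gapCubic α p m s = 0 →
      2 * α * (m + 1) * s - (1 - α) * (1 + α * (1 - 4 * p)) - 3 * α ^ 2 * (1 - 4 * p) * s ^ 2 = 0 := by
    intro s h0 h1 hs
    refine IsLocalMin.hasDerivAt_eq_zero ?_ (hasDerivAt_gapCubic α p m s)
    filter_upwards [Icc_mem_nhds h0 h1] with x hx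
    rw [hs]; exact hnn x hx
  have hs0' : 0 < s := by
    rcases hs0.eq_or_lt with h | h
    · rw [← h] at hs
      unfold gapCubic numeratorH quadFactor at hs
      have : m * (1 - α) = 0 := by linarith
      exact absurd this (mul_pos hm (by linarith)).ne'
    · exact h
  obtain ⟨q, hq⟩ : ∃ q, q = 1 - 4 * p := ⟨_, rfl⟩
  have hq0 : 0 ≤ q := by rw [hq]; linarith
  have hq1 : q < 1 := by rw [hq]; linarith
  have cs := hcrit s hs0' (hst.trans_le ht1) hs
  have hexp : ∀ x, gapCubic α p m x = m * (1 - α) - (1 - α) * (1 + α * q) * x +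
      α * (m + 1) * x ^ 2 - α ^ 2 * q * x ^ 3 := by
    intro x; rw [hq]; unfold gapCubic numeratorH quadFactor; ring
  rw [hexp] at hs ht
  rw [← hq] at cs
  -- Taylor expansion at the double zero `s`, evaluated at the second zero `t`.
  have e1 : (t - s) ^ 2 * (α * (m + 1 - α * q * (t + 2 * s))) = 0 := by
    linear_combination ht - hs - (t - s) * cs
  have e2 : m + 1 = α * q * (t + 2 * s) := by
    have h1 : (t - s) ^ 2 ≠ 0 := (pow_pos (sub_pos.mpr hst) 2).ne'
    have := (mul_eq_zero.mp ((mul_eq_zero.mp e1).resolve_left h1)).resolve_left hα0.ne'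
    linarith
  -- Two interior double zeros exceed the degree. If the second zero is the endpoint `1`, which need
  -- not be double, the coefficients force `(1-q)(1-α+αq) = 0`, excluded by `q < 1`.
  rcases ht1.lt_or_eq with h1 | h1
  · have ct := hcrit t (hs0'.trans hst) h1 (by rw [hexp]; exact ht)
    rw [← hq] at ct
    have e3 : (t - s) * (α ^ 2 * q * (t - s)) = 0 := by
      rw [mul_assoc 2 α, e2] at ct cs
      linear_combination cs - ct
    have e4 : α ^ 2 * q * (t - s) = 0 :=
      (mul_eq_zero.mp e3).resolve_left (sub_pos.mpr hst).ne'
    have e5 : q = 0 := by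
      rcases mul_eq_zero.mp e4 with h | h
      · exact (mul_eq_zero.mp h).resolve_left (by positivity)
      · linarith
    rw [e5] at e2
    linarith
  · subst h1
    have hm' : m = α * q * (1 + 2 * s) - 1 := by linarith
    subst hm'
    have f1 : α * q * s = 1 - α := by
      linear_combination (1 / 2) * (hs - (s - 1) * cs)
    have f2 : (1 - α) * (α * s + 2 * α - (1 + α * q)) = 0 := by
      linear_combination cs - (α * s + 2 * α) * f1
    have f3 : α * s + 2 * α = 1 + α * q := by
      have := (mul_eq_zero.mp f2).resolve_left (by linarith)
      linarith
    have f4 : (1 - q) * (1 - α + α * q) = 0 := by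
      linear_combination q * f3 - f1
    rcases mul_eq_zero.mp f4 with h | h
    · linarith
    · nlinarith [mul_nonneg hα0.le hq0]

end Discriminant

/-! ### Identification of the level and of the branch of the square root. -/

section Solution

/-- A tail sequence whose generating function solves the functional equation of the runoff. -/
structure IsTailSolution (α p : ℝ) (w : ℕ → ℝ) : Prop where
  pos : 0 < α
  lt_one : α < 1
  p_pos : 0 < p
  p_le : p ≤ 1 / 4
  antitone : Antitone w
  nonneg : ∀ n, 0 ≤ w n
  le_one : ∀ n, w n ≤ 1
  equation : ∀ t u : ℝ, 0 ≤ t → t < 1 → u = (1 - t) * ∑' k, w k * t ^ k →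
    t * (1 - u) = (α * t ^ 2 + (1 - α)) * (1 - u + p * u ^ 2) -
      (1 - α) * (1 - t) * (1 - w 0 + p * w 0 ^ 2)

/-- The signed square root of the discriminant selected by the generating function. -/
noncomputable def signedRoot (α p : ℝ) (w : ℕ → ℝ) (t : ℝ) : ℝ :=
  (1 - t) * (1 - α - α * t) - 2 * p * quadFactor α t * ((1 - t) * ∑' k, w k * t ^ k)

/-- The level of `gapCubic` determined by the probability of a positive runoff. -/
def tailLevel (α p : ℝ) (w : ℕ → ℝ) : ℝ := (1 - α) * (1 - 2 * p * w 0) ^ 2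

namespace IsTailSolution

variable {α p : ℝ} {w : ℕ → ℝ}

theorem summable (h : IsTailSolution α p w) (t : ℝ) (ht0 : 0 ≤ t) (ht1 : t < 1) :
    Summable fun n => w n * t ^ n :=
  Summable.of_nonneg_of_le (fun n => mul_nonneg (h.nonneg n) (pow_nonneg ht0 n))
    (fun n => mul_le_of_le_one_left (pow_nonneg ht0 n) (h.le_one n))
    (summable_geometric_of_lt_one ht0 ht1)

theorem tsum_nonneg (h : IsTailSolution α p w) {t : ℝ} (ht0 : 0 ≤ t) :
    0 ≤ ∑' k, w k * t ^ k :=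
  _root_.tsum_nonneg fun n => mul_nonneg (h.nonneg n) (pow_nonneg ht0 n)

theorem two_mul_p_mul_lt_one (h : IsTailSolution α p w) : 2 * p * w 0 < 1 := by
  nlinarith [h.le_one 0, h.p_pos, h.p_le, h.nonneg 0]

theorem tailLevel_pos (h : IsTailSolution α p w) : 0 < tailLevel α p w :=
  mul_pos (sub_pos.mpr h.lt_one) (pow_pos (sub_pos.mpr h.two_mul_p_mul_lt_one) 2)

/-- Completing the square in `u`; the level arises from `4p(1 - w₀ + p w₀²) = (1 - 2p w₀)² - (1 -
4p)`. -/
theorem signedRoot_sq (h : IsTailSolution α p w) {t : ℝ} (ht0 : 0 ≤ t) (ht1 : t < 1) :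
    signedRoot α p w t ^ 2 = (1 - t) * gapCubic α p (tailLevel α p w) t := by
  have e := h.equation t _ ht0 ht1 rfl
  unfold signedRoot gapCubic tailLevel numeratorH
  generalize (1 - t) * ∑' k, w k * t ^ k = u at e
  unfold quadFactor
  linear_combination (-4 * p * (α * t ^ 2 + (1 - α))) * e

theorem signedRoot_zero_pos (h : IsTailSolution α p w) : 0 < signedRoot α p w 0 := by
  have hz : ∑' k, w k * (0 : ℝ) ^ k = w 0 := by
    rw [tsum_eq_single 0 (fun k hk => by simp [hk])]; simp
  have : signedRoot α p w 0 = (1 - α) * (1 - 2 * p * w 0) := by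
    unfold signedRoot quadFactor; rw [hz]; ring
  rw [this]
  exact mul_pos (sub_pos.mpr h.lt_one) (sub_pos.mpr h.two_mul_p_mul_lt_one)

theorem continuousOn_signedRoot (h : IsTailSolution α p w) :
    ContinuousOn (signedRoot α p w) (Set.Ico 0 1) := by
  have hT : ContinuousOn (fun t => ∑' k, w k * t ^ k) (Set.Ico 0 1) := fun t ht =>
    (hasDerivAt_tsum_mul_pow h.summable ht.1 ht.2).continuousAt.continuousWithinAt
  unfold signedRoot quadFactor
  fun_prop

theorem gapCubic_nonneg (h : IsTailSolution α p w) {t : ℝ} (ht : t ∈ Set.Icc (0 : ℝ) 1) :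
    0 ≤ gapCubic α p (tailLevel α p w) t := by
  have hc : Continuous (gapCubic α p (tailLevel α p w)) := by
    unfold gapCubic quadFactor numeratorH; fun_prop
  have hsub : Set.Icc (0 : ℝ) 1 ⊆ {t | 0 ≤ gapCubic α p (tailLevel α p w) t} := by
    rw [← closure_Ico zero_ne_one]
    refine (isClosed_le continuous_const hc).closure_subset_iff.mpr fun t ht => ?_
    have := sq_nonneg (signedRoot α p w t)
    rw [h.signedRoot_sq ht.1 ht.2] at this
    exact nonneg_of_mul_nonneg_right this (sub_pos.mpr ht.2)
  exact hsub ht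

theorem signedRoot_pos_of_ne_zero (h : IsTailSolution α p w) {S : Set ℝ} (hS : IsPreconnected S)
    (hsub : S ⊆ Set.Ico 0 1) (hne : ∀ t ∈ S, signedRoot α p w t ≠ 0) {s : ℝ} (hs : s ∈ S)
    (hpos : 0 < signedRoot α p w s) {t : ℝ} (ht : t ∈ S) : 0 < signedRoot α p w t := by
  by_contra hneg
  obtain ⟨x, hx, hx0⟩ := hS.intermediate_value ht hs (h.continuousOn_signedRoot.mono hsub)
    ⟨not_lt.mp hneg, hpos.le⟩
  exact hne x hx hx0

/-- If the positive square root is selected near `1`, then `α ≤ 1 / 2` and the level is that of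
`h 1`. -/
theorem of_signedRoot_pos (h : IsTailSolution α p w) {s : ℝ} (hs0 : 0 ≤ s) (hs1 : s < 1)
    (hpos : ∀ t ∈ Set.Ioo s 1, 0 < signedRoot α p w t) :
    α ≤ 1 / 2 ∧ gapCubic α p (tailLevel α p w) 1 ≤ 0 := by
  -- Since `T ≥ 0`, a positive root is `O(1-t)`, so its square, divided by `1-t`, leaves `gapCubic`
  -- a nonpositive limit at `1`.
  have hle : ∀ t ∈ Set.Ioo s 1, signedRoot α p w t ≤ (1 - t) * (1 - α - α * t) := by
    intro t ht
    have h1 := quadFactor_pos h.pos h.lt_one t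
    have h2 := h.tsum_nonneg (hs0.trans ht.1.le)
    have : 0 ≤ 2 * p * quadFactor α t * ((1 - t) * ∑' k, w k * t ^ k) :=
      mul_nonneg (mul_nonneg (by linarith [h.p_pos]) h1.le)
        (mul_nonneg (sub_nonneg.mpr ht.2.le) h2)
    unfold signedRoot; linarith
  have hev : ∀ᶠ t : ℝ in 𝓝[<] 1, t ∈ Set.Ioo s 1 := Ioo_mem_nhdsLT hs1
  have hfac : ∀ t ∈ Set.Ioo s 1, 0 < 1 - α - α * t := fun t ht =>
    pos_of_mul_pos_right ((hpos t ht).trans_le (hle t ht)) (sub_nonneg.mpr ht.2.le)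
  constructor
  · have hc : Tendsto (fun t : ℝ => 1 - α - α * t) (𝓝[<] 1) (𝓝 (1 - α - α * 1)) :=
      (Continuous.tendsto (by fun_prop) 1).mono_left nhdsWithin_le_nhds
    have := ge_of_tendsto hc (hev.mono fun t ht => (hfac t ht).le)
    linarith
  · have hc : Tendsto (gapCubic α p (tailLevel α p w)) (𝓝[<] 1)
        (𝓝 (gapCubic α p (tailLevel α p w) 1)) :=
      (Continuous.tendsto (by unfold gapCubic quadFactor numeratorH; fun_prop) 1).mono_left
        nhdsWithin_le_nhds
    have hc' : Tendsto (fun t : ℝ => (1 - t) * (1 - α - α * t) ^ 2) (𝓝[<] 1)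
        (𝓝 ((1 - 1) * (1 - α - α * 1) ^ 2)) :=
      (Continuous.tendsto (by fun_prop) 1).mono_left nhdsWithin_le_nhds
    rw [sub_self, zero_mul] at hc'
    refine le_of_tendsto_of_tendsto hc hc' (hev.mono fun t ht => ?_)
    have h1 : 0 < 1 - t := sub_pos.mpr ht.2
    refine le_of_mul_le_mul_left ?_ h1
    rw [← h.signedRoot_sq (hs0.trans ht.1.le) ht.2]
    calc signedRoot α p w t ^ 2 ≤ ((1 - t) * (1 - α - α * t)) ^ 2 :=
          pow_le_pow_left₀ (hpos t ht).le (hle t ht) 2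
      _ = _ := by ring

theorem signedRoot_pos_of_gapCubic_ne_zero (h : IsTailSolution α p w)
    (hne : ∀ t ∈ Set.Ico (0 : ℝ) 1, gapCubic α p (tailLevel α p w) t ≠ 0) {t : ℝ}
    (ht : t ∈ Set.Ico (0 : ℝ) 1) : 0 < signedRoot α p w t := by
  refine h.signedRoot_pos_of_ne_zero isPreconnected_Ico subset_rfl (fun s hs h0 => hne s hs ?_)
    (Set.left_mem_Ico.mpr zero_lt_one) h.signedRoot_zero_pos ht
  have := h.signedRoot_sq hs.1 hs.2
  rw [h0, zero_pow two_ne_zero] at this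
  exact (mul_eq_zero.mp this.symm).resolve_left (sub_pos.mpr hs.2).ne'

/-- The level determined by the generating function is attained. -/
theorem exists_gapCubic_eq_zero (h : IsTailSolution α p w) :
    ∃ t ∈ Set.Icc (0 : ℝ) 1, gapCubic α p (tailLevel α p w) t = 0 := by
  by_cases hne : ∀ t ∈ Set.Ico (0 : ℝ) 1, gapCubic α p (tailLevel α p w) t ≠ 0
  · refine ⟨1, Set.right_mem_Icc.mpr zero_le_one, le_antisymm ?_
      (h.gapCubic_nonneg (Set.right_mem_Icc.mpr zero_le_one))⟩
    exact (h.of_signedRoot_pos le_rfl zero_lt_one fun t ht =>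
      h.signedRoot_pos_of_gapCubic_ne_zero hne ⟨ht.1.le, ht.2⟩).2
  · push Not at hne
    obtain ⟨t, ht, h0⟩ := hne
    exact ⟨t, ⟨ht.1, ht.2.le⟩, h0⟩

theorem gapCubic_pos (h : IsTailSolution α p w) {s t : ℝ} (hs : s ∈ Set.Icc (0 : ℝ) 1)
    (ht : t ∈ Set.Icc (0 : ℝ) 1) (hs0 : gapCubic α p (tailLevel α p w) s = 0) (hts : t ≠ s) :
    0 < gapCubic α p (tailLevel α p w) t := by
  refine (h.gapCubic_nonneg ht).lt_of_ne fun ht0 => ?_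
  rcases lt_or_gt_of_ne hts with hlt | hlt
  · exact gapCubic_zero_unique h.pos h.lt_one h.p_pos h.p_le h.tailLevel_pos
      (fun t ht => h.gapCubic_nonneg ht) ht.1 hlt hs.2 ht0.symm hs0
  · exact gapCubic_zero_unique h.pos h.lt_one h.p_pos h.p_le h.tailLevel_pos
      (fun t ht => h.gapCubic_nonneg ht) hs.1 hlt ht.2 hs0 ht0.symm

/-- Here `gapQuadratic` is positive on `[0,1)`, so at the level of `h 1` the cubic is positive
there. The true level is at least that one, so the zero can only be at `1`. -/
theorem gapCubic_eq_zero_at_one (h : IsTailSolution α p w) (hα : α ≤ 1 / 2)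
    (hR : 0 ≤ gapQuadratic α p 1) : gapCubic α p (tailLevel α p w) 1 = 0 := by
  obtain ⟨s, hs, hs0⟩ := h.exists_gapCubic_eq_zero
  rcases hs.2.lt_or_eq with h1 | h1
  · exfalso
    have hq := mul_pos (sub_pos.mpr h1)
      (hR.trans_lt (gapQuadratic_one_lt h.pos hα h.p_pos hs.1 h1))
    rw [← gapCubic_at_one] at hq
    have h2 := h.gapCubic_nonneg (Set.right_mem_Icc.mpr zero_le_one)
    have h3 : 0 ≤ tailLevel α p w - numeratorH α p 1 := by
      unfold gapCubic quadFactor at h2; linarith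
    have h4 := mul_nonneg h3 (quadFactor_pos h.pos h.lt_one s).le
    unfold gapCubic at hs0 hq
    linarith
  · rwa [h1] at hs0

/-- The generating function of the tail below and at the critical value. -/
theorem tsum_eq_of_subcritical (h : IsTailSolution α p w) (hα : α ≤ 1 / 2)
    (hR : 0 ≤ gapQuadratic α p 1) {t : ℝ} (ht : t ∈ Set.Ico (0 : ℝ) 1) :
    ∑' k, w k * t ^ k =
      (1 - α - α * t - √(gapQuadratic α p t)) / (2 * p * quadFactor α t) := by
  have h1 := h.gapCubic_eq_zero_at_one hα hR
  have hm : tailLevel α p w = numeratorH α p 1 := by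
    unfold gapCubic quadFactor at h1; linarith
  have hpos := h.signedRoot_pos_of_gapCubic_ne_zero (fun s hs => (h.gapCubic_pos
    (Set.right_mem_Icc.mpr zero_le_one) ⟨hs.1, hs.2.le⟩ h1 hs.2.ne).ne') ht
  have hsq := h.signedRoot_sq ht.1 ht.2
  have ht' : 0 < 1 - t := sub_pos.mpr ht.2
  rw [hm, gapCubic_at_one, ← mul_assoc, ← sq] at hsq
  have hroot : signedRoot α p w t = (1 - t) * √(gapQuadratic α p t) := by
    rw [← Real.sqrt_sq hpos.le, hsq, Real.sqrt_mul (by positivity), Real.sqrt_sq ht'.le]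
  have hA := quadFactor_pos h.pos h.lt_one t
  have hp := h.p_pos
  rw [eq_div_iff (by positivity)]
  refine mul_left_cancel₀ ht'.ne' ?_
  unfold signedRoot at hroot
  linear_combination -hroot

theorem exists_zero_lt_one_of_supercritical (h : IsTailSolution α p w)
    (hα : 1 / 2 < α ∨ gapQuadratic α p 1 < 0) :
    ∃ s ∈ Set.Ico (0 : ℝ) 1, gapCubic α p (tailLevel α p w) s = 0 := by
  obtain ⟨s, hs, hs0⟩ := h.exists_gapCubic_eq_zero
  rcases hs.2.lt_or_eq with h1 | h1
  · exact ⟨s, ⟨hs.1, h1⟩, hs0⟩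
  · exfalso
    rw [h1] at hs0
    rcases hα with hα | hR
    · have := (h.of_signedRoot_pos le_rfl zero_lt_one fun t ht =>
        h.signedRoot_pos_of_gapCubic_ne_zero (fun s hs => (h.gapCubic_pos
          (Set.right_mem_Icc.mpr zero_le_one) ⟨hs.1, hs.2.le⟩ hs0 hs.2.ne).ne')
          ⟨ht.1.le, ht.2⟩).1
      linarith
    -- A zero at `1` gives `gapCubic = (1-t) * gapQuadratic`, negative just before `1`, against its
    -- nonnegativity.
    · have hm : tailLevel α p w = numeratorH α p 1 := by
        unfold gapCubic quadFactor at hs0; linarith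
      have hc : Tendsto (gapQuadratic α p) (𝓝[<] 1) (𝓝 (gapQuadratic α p 1)) :=
        (Continuous.tendsto (by unfold gapQuadratic; fun_prop) 1).mono_left nhdsWithin_le_nhds
      obtain ⟨t, ht, ht'⟩ := (((tendsto_order.1 hc).2 0 hR).and
        (Ioo_mem_nhdsLT (zero_lt_one (α := ℝ)))).exists
      have := h.gapCubic_nonneg ⟨ht'.1.le, ht'.2.le⟩
      rw [hm, gapCubic_at_one] at this
      have := mul_neg_of_pos_of_neg (sub_pos.mpr ht'.2) ht
      linarith

/-- The generating function of the tail near `1` above the critical value. -/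
theorem sqrt_mul_eq_of_supercritical (h : IsTailSolution α p w) {s : ℝ}
    (hs : s ∈ Set.Ico (0 : ℝ) 1) (hs0 : gapCubic α p (tailLevel α p w) s = 0) {t : ℝ}
    (ht : t ∈ Set.Ioo s 1) :
    √(1 - t) * (1 - α - α * t - 2 * p * quadFactor α t * ∑' k, w k * t ^ k) =
      -√(gapCubic α p (tailLevel α p w) t) := by
  have hsI : s ∈ Set.Icc (0 : ℝ) 1 := ⟨hs.1, hs.2.le⟩
  have hgap : ∀ x, s < x → x ≤ 1 → 0 < gapCubic α p (tailLevel α p w) x := fun x h1 h2 =>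
    h.gapCubic_pos hsI ⟨hs.1.trans h1.le, h2⟩ hs0 h1.ne'
  have hne : ∀ x ∈ Set.Ioo s 1, signedRoot α p w x ≠ 0 := by
    intro x hx h0
    have := h.signedRoot_sq (hs.1.trans hx.1.le) hx.2
    rw [h0, zero_pow two_ne_zero] at this
    exact (mul_pos (sub_pos.mpr hx.2) (hgap x hx.1 hx.2.le)).ne this
  -- The root does not vanish on `(s,1)`; a positive sign there would force `gapCubic ≤ 0` at `1`,
  -- where it is positive.
  have hneg : signedRoot α p w t < 0 := by
    refine lt_of_le_of_ne (not_lt.mp fun hpos => ?_) (hne t ht)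
    have := (h.of_signedRoot_pos hs.1 hs.2 fun x hx =>
      h.signedRoot_pos_of_ne_zero isPreconnected_Ioo
        (fun y hy => ⟨hs.1.trans hy.1.le, hy.2⟩) hne ht hpos hx).2
    exact absurd this (not_le.mpr (hgap 1 hs.2 le_rfl))
  have hsq := h.signedRoot_sq (hs.1.trans ht.1.le) ht.2
  have ht' : 0 < 1 - t := sub_pos.mpr ht.2
  have hroot : -signedRoot α p w t = √(1 - t) * √(gapCubic α p (tailLevel α p w) t) := by
    rw [← Real.sqrt_mul ht'.le, ← hsq, Real.sqrt_sq_eq_abs, abs_of_neg hneg]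
  have hs' : √(1 - t) * √(1 - t) = 1 - t := Real.mul_self_sqrt ht'.le
  refine mul_left_cancel₀ (Real.sqrt_pos.mpr ht').ne' ?_
  unfold signedRoot at hroot
  linear_combination -hroot +
    (1 - α - α * t - 2 * p * quadFactor α t * ∑' k, w k * t ^ k) * hs'

end IsTailSolution

end Solution

/-! ### Tail asymptotics in the three regimes. -/

section Asymptotic

theorem isEquivalent_floor_of_tendsto {w : ℕ → ℝ} {K : ℝ} (hK : 0 < K) (j : ℕ)
    (h : Tendsto (fun n : ℕ => (n : ℝ) ^ j * w n * √n) atTop (𝓝 K)) :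
    (fun x : ℝ => w ⌊x⌋₊) ~[atTop] fun x : ℝ => K * x ^ (-((j : ℝ) + 1 / 2)) := by
  have hfl : Tendsto (fun x : ℝ => ⌊x⌋₊) atTop atTop := tendsto_nat_floor_atTop
  have hr : Tendsto (fun x : ℝ => x / (⌊x⌋₊ : ℝ)) atTop (𝓝 1) := by
    simpa using (tendsto_nat_floor_div_atTop (R := ℝ)).inv₀ one_ne_zero
  have hlim := (((h.comp hfl).div_const K).mul (hr.pow j)).mul
    ((Real.continuous_sqrt.tendsto 1).comp hr)
  rw [div_self hK.ne', one_pow, Real.sqrt_one, one_mul, one_mul] at hlim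
  refine (isEquivalent_iff_tendsto_one ?_).mpr (hlim.congr' ?_)
  · filter_upwards [eventually_gt_atTop 0] with x hx
    exact (mul_pos hK (Real.rpow_pos_of_pos hx _)).ne'
  · filter_upwards [eventually_ge_atTop 1] with x hx
    have hx0 : 0 < x := by linarith
    have hn : (0 : ℝ) < ⌊x⌋₊ := by exact_mod_cast Nat.floor_pos.mpr hx
    have hs : 0 < √(⌊x⌋₊ : ℝ) := Real.sqrt_pos.mpr hn
    have hsx : 0 < √x := Real.sqrt_pos.mpr hx0
    have e : x ^ (-((j : ℝ) + 1 / 2)) = (x ^ j * √x)⁻¹ := by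
      rw [Real.rpow_neg hx0.le, Real.rpow_add hx0, Real.rpow_natCast, Real.sqrt_eq_rpow]
    simp only [Function.comp_apply, Pi.div_apply]
    rw [e, Real.sqrt_div hx0.le, div_pow]
    field_simp

variable {α p : ℝ} {w : ℕ → ℝ}

namespace IsTailSolution

theorem isEquivalent_of_supercritical (h : IsTailSolution α p w) {s : ℝ}
    (hs : s ∈ Set.Ico (0 : ℝ) 1) (hs0 : gapCubic α p (tailLevel α p w) s = 0) :
    (fun x : ℝ => w ⌊x⌋₊) ~[atTop] fun x : ℝ =>
      √(gapCubic α p (tailLevel α p w) 1) / (2 * p) / √Real.pi * x ^ (-(1 / 2) : ℝ) := by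
  have hp := h.p_pos
  have hg1 : 0 < gapCubic α p (tailLevel α p w) 1 :=
    h.gapCubic_pos ⟨hs.1, hs.2.le⟩ (Set.right_mem_Icc.mpr zero_le_one) hs0 hs.2.ne'
  set C := √(gapCubic α p (tailLevel α p w) 1) / (2 * p) with hCdef
  have hC : 0 < C := div_pos (Real.sqrt_pos.mpr hg1) (by linarith)
  have hlim : Tendsto (fun t : ℝ => √(1 - t) * ∑' n, w n * t ^ n) (𝓝[<] 1) (𝓝 C) := by
    have hc : Tendsto (fun t : ℝ => (√(1 - t) * (1 - α - α * t) +
        √(gapCubic α p (tailLevel α p w) t)) / (2 * p * quadFactor α t)) (𝓝[<] 1)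
        (𝓝 ((√(1 - 1) * (1 - α - α * 1) +
          √(gapCubic α p (tailLevel α p w) 1)) / (2 * p * quadFactor α 1))) := by
      refine ContinuousAt.tendsto (x := (1 : ℝ)) (f := fun t : ℝ => (√(1 - t) * (1 - α - α * t) +
        √(gapCubic α p (tailLevel α p w) t)) / (2 * p * quadFactor α t)) ?_ |>.mono_left
          nhdsWithin_le_nhds
      refine ContinuousAt.div ?_ ?_ ?_
      · unfold gapCubic quadFactor numeratorH; fun_prop
      · unfold quadFactor; fun_prop
      · exact (mul_pos (by linarith) (quadFactor_pos h.pos h.lt_one 1)).ne'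
    have e : (√(1 - 1) * (1 - α - α * 1) + √(gapCubic α p (tailLevel α p w) 1)) /
        (2 * p * quadFactor α 1) = C := by
      have : quadFactor α 1 = 1 := by unfold quadFactor; ring
      rw [this, sub_self, Real.sqrt_zero, zero_mul, zero_add, mul_one]
    rw [e] at hc
    refine hc.congr' ?_
    filter_upwards [Ioo_mem_nhdsLT hs.2] with t ht
    have := h.sqrt_mul_eq_of_supercritical hs hs0 ht
    have hA := quadFactor_pos h.pos h.lt_one t
    rw [div_eq_iff (by positivity)]
    linear_combination this
  have hsum := tendsto_partialSum_of_tendsto_abel h.nonneg hC.le h.summable hlim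
  have hsum' : Tendsto (fun N : ℕ => (∑ n ∈ Finset.range N, (n : ℝ) ^ 0 * w n) / √N) atTop
      (𝓝 (2 * C / √Real.pi)) := by
    have h0 : Tendsto (fun N : ℕ => w N / √N) atTop (𝓝 0) := by
      refine squeeze_zero (fun N => div_nonneg (h.nonneg N) (Real.sqrt_nonneg _))
        (fun N => div_le_div_of_nonneg_right (h.le_one N) (Real.sqrt_nonneg _)) ?_
      simp only [one_div]
      exact (Real.tendsto_sqrt_atTop.comp tendsto_natCast_atTop_atTop).inv_tendsto_atTop
    have := hsum.sub h0
    rw [sub_zero] at this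
    refine this.congr fun N => ?_
    rw [Finset.sum_range_succ, ← sub_div, add_sub_cancel_right]
    simp
  have hfin := tendsto_of_tendsto_partialSum_of_antitone 0 h.antitone h.nonneg hsum'
  rw [show 2 * C / √Real.pi / 2 = C / √Real.pi by ring] at hfin
  have := isEquivalent_floor_of_tendsto (div_pos hC (Real.sqrt_pos.mpr Real.pi_pos)) 0 hfin
  simpa using this

/-- The linear factor of `gapQuadratic` at the critical value. -/
def _root_.gapLinear (α p t : ℝ) : ℝ :=
  (1 - α) * (1 - α - 4 * p * α) - α ^ 2 * (1 - 4 * p) * t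

theorem _root_.gapQuadratic_eq_of_critical (hR : gapQuadratic α p 1 = 0) (t : ℝ) :
    gapQuadratic α p t = (1 - t) * gapLinear α p t := by
  unfold gapQuadratic at hR ⊢
  unfold gapLinear
  linear_combination t * hR

theorem gapLinear_one_pos (h : IsTailSolution α p w) (hα : α ≤ 1 / 2)
    (hR : gapQuadratic α p 1 = 0) : 0 < gapLinear α p 1 := by
  have e : gapLinear α p 1 = 2 * α * (1 - α - α * (1 - 4 * p)) := by
    unfold gapQuadratic at hR
    unfold gapLinear
    linear_combination hR
  rw [e]
  have := mul_pos h.pos h.p_pos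
  exact mul_pos (by linarith [h.pos]) (by linarith)

theorem gapLinear_pos (h : IsTailSolution α p w) (hα : α ≤ 1 / 2)
    (hR : gapQuadratic α p 1 = 0) {t : ℝ} (ht : t < 1) : 0 < gapLinear α p t := by
  have h1 := h.gapLinear_one_pos hα hR
  have h2 : 0 ≤ α ^ 2 * (1 - 4 * p) * (1 - t) :=
    mul_nonneg (mul_nonneg (sq_nonneg _) (by linarith [h.p_le])) (by linarith)
  unfold gapLinear at h1 ⊢
  linarith

/-- At criticality `√gapQuadratic = √(1-t) * √gapLinear`: the series stays bounded at `1`, and only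
its derivative has the singularity that the Tauberian theorem can read. -/
theorem tendsto_deriv_of_critical (h : IsTailSolution α p w) (hα : α ≤ 1 / 2)
    (hR : gapQuadratic α p 1 = 0) :
    Tendsto (fun t : ℝ => √(1 - t) * ∑' n : ℕ, ((n : ℝ) + 1) * w (n + 1) * t ^ n) (𝓝[<] 1)
      (𝓝 (√(gapLinear α p 1) / (4 * p))) := by
  have hp := h.p_pos
  have hL1 := h.gapLinear_one_pos hα hR
  set g : ℝ → ℝ := fun t => √(1 - t) * √(gapLinear α p t) with hg
  -- `G = √(1-t) * g'` and `F = √(1-t) * T'`, written so as to be continuous at `1`.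
  set G : ℝ → ℝ := fun t => -(√(gapLinear α p t) / 2) -
    (1 - t) * (α ^ 2 * (1 - 4 * p)) / (2 * √(gapLinear α p t)) with hG
  set F : ℝ → ℝ := fun t => ((-(√(1 - t) * α) - G t) * (2 * p * quadFactor α t) -
    √(1 - t) * (1 - α - α * t - g t) * (2 * p * (2 * α * t))) / (2 * p * quadFactor α t) ^ 2 with hF
  have hc : Tendsto F (𝓝[<] 1) (𝓝 (F 1)) := by
    refine ContinuousAt.tendsto (x := (1 : ℝ)) ?_ |>.mono_left nhdsWithin_le_nhds
    have hGc : ContinuousAt G 1 := by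
      have hl : ContinuousAt (gapLinear α p) 1 := by unfold gapLinear; fun_prop
      have hne : 2 * √(gapLinear α p 1) ≠ 0 := by
        have := Real.sqrt_pos.mpr hL1; positivity
      exact ((hl.sqrt.div_const 2).neg).sub
        (ContinuousAt.div (by fun_prop) (hl.sqrt.const_mul 2) hne)
    have hA : ContinuousAt (quadFactor α) 1 := by unfold quadFactor; fun_prop
    have hgc : ContinuousAt g 1 := by rw [hg]; unfold gapLinear; fun_prop
    refine ContinuousAt.div ?_ ?_ ?_
    · fun_prop
    · fun_prop
    · exact pow_ne_zero _ (mul_pos (by linarith) (quadFactor_pos h.pos h.lt_one 1)).ne'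
  have e : F 1 = √(gapLinear α p 1) / (4 * p) := by
    have : quadFactor α 1 = 1 := by unfold quadFactor; ring
    simp only [hF, hG, this, sub_self, Real.sqrt_zero, zero_mul, zero_div, sub_zero, mul_one,
      neg_zero, zero_sub, neg_neg]
    field_simp
    ring
  rw [← e]
  refine hc.congr' ?_
  filter_upwards [Ioo_mem_nhdsLT (zero_lt_one (α := ℝ))] with t ht
  have ht' : 0 < 1 - t := sub_pos.mpr ht.2
  have hL := h.gapLinear_pos hα hR ht.2
  have hA := quadFactor_pos h.pos h.lt_one t
  have hs : 0 < √(1 - t) := Real.sqrt_pos.mpr ht'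
  have hsL : 0 < √(gapLinear α p t) := Real.sqrt_pos.mpr hL
  have hss : √(1 - t) ^ 2 = 1 - t := Real.sq_sqrt ht'.le
  have hd1 : HasDerivAt g (G t / √(1 - t)) t := by
    have a1 := ((hasDerivAt_id t).const_sub 1).sqrt ht'.ne'
    have a2 : HasDerivAt (gapLinear α p) (-(α ^ 2 * (1 - 4 * p))) t := by
      have := ((hasDerivAt_id t).const_mul (α ^ 2 * (1 - 4 * p))).const_sub
        ((1 - α) * (1 - α - 4 * p * α))
      convert! this using 1
      simp
    convert! a1.mul (a2.sqrt hL.ne') using 1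
    simp only [hG, id]
    field_simp
    rw [hss]
    ring
  have hd2 : HasDerivAt (quadFactor α) (2 * α * t) t := by
    have := ((hasDerivAt_pow 2 t).const_mul α).add_const (1 - α)
    convert! this using 1
    simp; ring
  have hd3 : HasDerivAt (fun t => 1 - α - α * t) (-α) t := by
    simpa using ((hasDerivAt_id t).const_mul α).const_sub (1 - α)
  have hd := (hd3.sub hd1).div (hd2.const_mul (2 * p)) (mul_pos (by linarith) hA).ne'
  have hT := hasDerivAt_tsum_mul_pow h.summable ht.1.le ht.2
  have heq : (fun t => ∑' n, w n * t ^ n) =ᶠ[𝓝 t]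
      (((fun t => 1 - α - α * t) - g) / fun t => 2 * p * quadFactor α t) := by
    filter_upwards [Ioo_mem_nhds ht.1 ht.2] with x hx
    rw [h.tsum_eq_of_subcritical hα hR.ge ⟨hx.1.le, hx.2⟩, gapQuadratic_eq_of_critical hR,
      Real.sqrt_mul (sub_pos.mpr hx.2).le]
    rfl
  rw [hT.unique (hd.congr_of_eventuallyEq heq)]
  simp only [hF, Pi.sub_apply]
  field_simp

theorem isEquivalent_of_critical (h : IsTailSolution α p w) (hα : α ≤ 1 / 2)
    (hR : gapQuadratic α p 1 = 0) :
    (fun x : ℝ => w ⌊x⌋₊) ~[atTop] fun x : ℝ =>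
      √(gapLinear α p 1) / (4 * p) / √Real.pi * x ^ (-(3 / 2) : ℝ) := by
  have hp := h.p_pos
  set C := √(gapLinear α p 1) / (4 * p) with hCdef
  have hC : 0 < C := div_pos (Real.sqrt_pos.mpr (h.gapLinear_one_pos hα hR)) (by linarith)
  have hsum := tendsto_partialSum_of_tendsto_abel
    (a := fun n : ℕ => ((n : ℝ) + 1) * w (n + 1))
    (fun n => mul_nonneg (by positivity) (h.nonneg _)) hC.le
    (fun t ht0 ht1 => summable_succ_mul_succ_pow h.summable ht0 ht1)
    (h.tendsto_deriv_of_critical hα hR)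
  have hsum' : Tendsto (fun N : ℕ => (∑ n ∈ Finset.range N, (n : ℝ) ^ 1 * w n) / √N) atTop
      (𝓝 (2 * C / √Real.pi)) := by
    -- The sum of `n * w n` over `n < N + 2` is the sum of `(n+1) * w (n+1)` over `n < N + 1`, as
    -- the term `n = 0` vanishes.
    rw [← tendsto_add_atTop_iff_nat 2]
    have hr : Tendsto (fun N : ℕ => √((N : ℝ) / ((N + 2 : ℕ) : ℝ))) atTop (𝓝 1) := by
      have h1 : Tendsto (fun N : ℕ => (N : ℝ) / ((N + 2 : ℕ) : ℝ)) atTop (𝓝 1) := by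
        have := tendsto_natCast_div_add_atTop (𝕜 := ℝ) 2
        simpa using this
      have := (Real.continuous_sqrt.tendsto 1).comp h1
      rwa [Real.sqrt_one] at this
    have := hsum.mul hr
    rw [mul_one] at this
    refine this.congr' ?_
    filter_upwards [eventually_gt_atTop 0] with N hN
    have hN' : 0 < √(N : ℝ) := Real.sqrt_pos.mpr (by exact_mod_cast hN)
    have e : ∑ n ∈ Finset.range (N + 2), (n : ℝ) ^ 1 * w n =
        ∑ n ∈ Finset.range (N + 1), ((n : ℝ) + 1) * w (n + 1) := by
      rw [Finset.sum_range_succ']; simp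
    rw [e, Real.sqrt_div (Nat.cast_nonneg _)]
    field_simp
  have hfin := tendsto_of_tendsto_partialSum_of_antitone 1 h.antitone h.nonneg hsum'
  rw [show 2 * C / √Real.pi / 2 = C / √Real.pi by ring] at hfin
  have := isEquivalent_floor_of_tendsto (div_pos hC (Real.sqrt_pos.mpr Real.pi_pos)) 1 hfin
  norm_num at this ⊢
  exact this

theorem summable_pow_mul_of_subcritical (h : IsTailSolution α p w) (hα : α ≤ 1 / 2)
    (hR : 0 < gapQuadratic α p 1) (m : ℕ) : Summable fun k : ℕ => ((k : ℝ) + 1) ^ m * w k := by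
  refine summable_pow_mul_of_analyticAt m h.nonneg h.summable
    (ψ := fun t => (1 - α - α * t - √(gapQuadratic α p t)) / (2 * p * quadFactor α t)) ?_ ?_
  -- Here the order `⊤` means analyticity, not merely `C^∞`; it holds because the radicand is
  -- positive at `1`.
  · have hc : ContDiffAt ℝ ⊤ (fun t => (1 - α - α * t - √(gapQuadratic α p t)) /
        (2 * p * quadFactor α t)) 1 := by
      refine ContDiffAt.div (ContDiffAt.sub (by fun_prop) (ContDiffAt.sqrt ?_ hR.ne')) ?_ ?_
      · unfold gapQuadratic; fun_prop
      · unfold quadFactor; fun_prop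
      · exact (mul_pos (by linarith [h.p_pos]) (quadFactor_pos h.pos h.lt_one 1)).ne'
    have := contDiffWithinAt_omega_iff_analyticWithinAt.mp (contDiffWithinAt_univ.mpr hc)
    rwa [analyticWithinAt_univ] at this
  · filter_upwards [Ioo_mem_nhdsLT (zero_lt_one (α := ℝ))] with t ht
    exact h.tsum_eq_of_subcritical hα hR.le ⟨ht.1.le, ht.2⟩

end IsTailSolution

end Asymptotic

/-! ### Translation back to `h` and `α_c`. -/

section Main

variable {α β : ℝ}

theorem runoffH_eq_div (α β t : ℝ) : runoffH α β t = numeratorH α (β * (1 - β)) t /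
    (4 * (1 - α) * (β * (1 - β)) ^ 2 * quadFactor α t) := by
  unfold runoffH numeratorH quadFactor
  congr 1 <;> ring

theorem sub_runoffH (hα0 : 0 < α) (hα1 : α < 1) (hp : 0 < β * (1 - β)) (m t : ℝ) :
    m / (4 * (1 - α) * (β * (1 - β)) ^ 2) - runoffH α β t =
      gapCubic α (β * (1 - β)) m t / (4 * (1 - α) * (β * (1 - β)) ^ 2 * quadFactor α t) := by
  have hA := quadFactor_pos hα0 hα1 t
  have hb := sub_pos.mpr hα1
  rw [runoffH_eq_div]
  unfold gapCubic
  generalize β * (1 - β) = p at *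
  field_simp

theorem sub_eq_of_gapCubic_eq_zero (hα0 : 0 < α) (hα1 : α < 1) (hp : 0 < β * (1 - β)) {m s : ℝ}
    (hs : gapCubic α (β * (1 - β)) m s = 0) (t : ℝ) :
    runoffH α β s - runoffH α β t =
      gapCubic α (β * (1 - β)) m t / (4 * (1 - α) * (β * (1 - β)) ^ 2 * quadFactor α t) := by
  have h1 := sub_runoffH hα0 hα1 hp m s
  rw [hs, zero_div] at h1
  rw [← sub_runoffH hα0 hα1 hp m t]
  linarith

/-- At criticality `h(1) - h(t)` has the factor `(1-t)^2`, so `h''(1)` is read off without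
differentiating the rational function twice. -/
theorem iteratedDeriv_two_const_sub_sq_mul {f g : ℝ → ℝ} {c : ℝ} (hg : ContDiff ℝ 2 g)
    (hf : ∀ t, f t = c - (1 - t) ^ 2 * g t) : iteratedDeriv 2 f 1 = -2 * g 1 := by
  have hd : ∀ t, HasDerivAt f ((1 - t) * (2 * g t - (1 - t) * deriv g t)) t := by
    intro t
    have h1 := ((hasDerivAt_id t).const_sub 1).pow 2
    have h2 := (hg.differentiable two_ne_zero t).hasDerivAt
    rw [show f = fun t => c - (1 - t) ^ 2 * g t from funext hf]
    convert! (h1.mul h2).const_sub c using 1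
    simp; ring
  have hd' : deriv f = fun t => (1 - t) * (2 * g t - (1 - t) * deriv g t) :=
    funext fun t => (hd t).deriv
  rw [iteratedDeriv_succ, iteratedDeriv_one, hd']
  have hdg : Differentiable ℝ (deriv g) :=
    ((contDiff_succ_iff_deriv (n := 1)).mp hg).2.2.differentiable one_ne_zero
  have h3 : DifferentiableAt ℝ (fun t => 2 * g t - (1 - t) * deriv g t) 1 := by
    have := hg.differentiable two_ne_zero
    fun_prop
  have h4 := ((hasDerivAt_id (1 : ℝ)).const_sub 1).mul h3.hasDerivAt
  refine h4.deriv.trans ?_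
  simp

theorem iteratedDeriv_runoffH_of_critical (hα0 : 0 < α) (hα1 : α < 1) (hp : 0 < β * (1 - β))
    (hR : gapQuadratic α (β * (1 - β)) 1 = 0) :
    iteratedDeriv 2 (runoffH α β) 1 =
      -2 * (gapLinear α (β * (1 - β)) 1 / (4 * (1 - α) * (β * (1 - β)) ^ 2)) := by
  have hq : quadFactor α 1 = 1 := by unfold quadFactor; ring
  have hb := sub_pos.mpr hα1
  have h := iteratedDeriv_two_const_sub_sq_mul (f := runoffH α β)
    (c := numeratorH α (β * (1 - β)) 1 / (4 * (1 - α) * (β * (1 - β)) ^ 2))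
    (g := fun t => gapLinear α (β * (1 - β)) t /
      (4 * (1 - α) * (β * (1 - β)) ^ 2 * quadFactor α t)) ?_ fun t => ?_
  · rw [h, hq, mul_one]
  · refine ContDiff.div ?_ ?_ fun t => ?_
    · unfold gapLinear; fun_prop
    · unfold quadFactor; fun_prop
    · exact (mul_pos (by positivity) (quadFactor_pos hα0 hα1 t)).ne'
  · have := sub_runoffH hα0 hα1 hp (numeratorH α (β * (1 - β)) 1) t
    rw [gapCubic_at_one, gapQuadratic_eq_of_critical hR] at this
    linear_combination -this

theorem IsRunoffModel.isTailSolution {Ω : Type*} [MeasurableSpace Ω] {P : Measure Ω}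
    [IsProbabilityMeasure P] {Z : List ℕ → Ω → ℕ} {X : List ℕ → Ω → ℝ}
    (hM : IsRunoffModel P α β Z X) (hα0 : 0 < α) (hα1 : α < 1) (hβ0 : 0 < β) (hβ1 : β ≤ 1 / 2) :
    IsTailSolution α (β * (1 - β)) (runoffTail P Z X) where
  pos := hα0
  lt_one := hα1
  p_pos := mul_pos hβ0 (by linarith)
  p_le := by nlinarith [sq_nonneg (β - 1 / 2)]
  antitone := runoffTail_antitone
  nonneg _ := measureReal_nonneg
  le_one _ := measureReal_le_one
  equation _ _ ht0 ht1 hu := hM.runoffTail_equation hα0 hα1 hβ0 hβ1 ht0 ht1 hu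

/-- The roots in `α` are `α_c` and a number above `1/2`. Hence for `α ≤ 1/2` the sign is that of
`α_c - α`. -/
theorem gapQuadratic_one_eq_mul (hp : 0 < β * (1 - β)) :
    gapQuadratic α (β * (1 - β)) 1 = 4 * (criticalAlpha β - α) *
      (criticalAlpha β - α + √(β * (1 - β) * (2 + β * (1 - β)))) := by
  have hs := Real.sq_sqrt (show 0 ≤ β * (1 - β) * (2 + β * (1 - β)) by positivity)
  rw [gapQuadratic_one, criticalAlpha]
  linear_combination hs

theorem criticalAlpha_lt_half (hp : 0 < β * (1 - β)) : criticalAlpha β < 1 / 2 := by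
  have : β * (1 - β) < √(β * (1 - β) * (2 + β * (1 - β))) :=
    Real.lt_sqrt_of_sq_lt (by nlinarith)
  unfold criticalAlpha
  linarith

theorem half_lt_criticalAlpha_add_sqrt (hp : 0 < β * (1 - β)) :
    1 / 2 < criticalAlpha β + √(β * (1 - β) * (2 + β * (1 - β))) := by
  have := Real.sqrt_nonneg (β * (1 - β) * (2 + β * (1 - β)))
  unfold criticalAlpha
  linarith

theorem mainTheorem2 {Ω : Type*} [MeasurableSpace Ω] (P : Measure Ω) [IsProbabilityMeasure P]
    (α β : ℝ) (hα0 : 0 < α) (hα1 : α < 1) (hβ0 : 0 < β) (hβ1 : β ≤ 1 / 2)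
    (Z : List ℕ → Ω → ℕ) (X : List ℕ → Ω → ℝ) (hM : IsRunoffModel P α β Z X)
    (W : Ω → ENNReal) (hW : ∀ ω, W ω = rootRunoff (fun v => Z v ω) (fun v => X v ω)) :
    ∃ t₀ ∈ Set.Icc (0 : ℝ) 1,
      (∀ t ∈ Set.Icc (0 : ℝ) 1, t ≠ t₀ → runoffH α β t < runoffH α β t₀) ∧
      (α = criticalAlpha β →
        (fun x : ℝ => P.real {ω | ENNReal.ofReal x < W ω}) ~[atTop]
          fun x : ℝ => √(-iteratedDeriv 2 (runoffH α β) 1 * (1 - α) / (8 * Real.pi)) *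
            x ^ (-(3 / 2) : ℝ)) ∧
      (criticalAlpha β < α →
        (fun x : ℝ => P.real {ω | ENNReal.ofReal x < W ω}) ~[atTop]
          fun x : ℝ => √((runoffH α β t₀ - runoffH α β 1) * (1 - α) / Real.pi) *
            x ^ (-(1 / 2) : ℝ)) ∧
      (α < criticalAlpha β →
        ∀ r : ℝ, 0 < r → ∫⁻ ω, W ω ^ r ∂P < ⊤) := by
  have h := hM.isTailSolution hα0 hα1 hβ0 hβ1
  have hp := h.p_pos
  have hb := sub_pos.mpr hα1
  obtain rfl : W = fun ω => rootRunoff (fun v => Z v ω) (fun v => X v ω) := funext hW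
  have htail : (fun x : ℝ => runoffTail P Z X ⌊x⌋₊) =ᶠ[atTop]
      fun x : ℝ => P.real {ω | ENNReal.ofReal x <
        rootRunoff (fun v => Z v ω) (fun v => X v ω)} := by
    filter_upwards [eventually_ge_atTop 0] with x hx
    exact (hM.measureReal_rootRunoff hα0 hα1 hx).symm
  have hlt := criticalAlpha_lt_half hp
  have hfac := gapQuadratic_one_eq_mul (α := α) hp
  have hgt := half_lt_criticalAlpha_add_sqrt hp
  -- The maximiser of `h` is the zero supplied by the probabilistic solution itself; no separate
  -- optimisation of `h` is needed.
  obtain ⟨s, hs, hs0⟩ := h.exists_gapCubic_eq_zero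
  refine ⟨s, hs, fun t ht hts => ?_, fun hα => ?_, fun hα => ?_, fun hα r hr => ?_⟩
  · rw [← sub_pos, sub_eq_of_gapCubic_eq_zero hα0 hα1 hp hs0]
    exact div_pos (h.gapCubic_pos hs ht hs0 hts)
      (mul_pos (by positivity) (quadFactor_pos hα0 hα1 t))
  · have hR : gapQuadratic α (β * (1 - β)) 1 = 0 := by rw [hfac, hα]; ring
    have hα2 : α ≤ 1 / 2 := by linarith
    have hL := h.gapLinear_one_pos hα2 hR
    rw [iteratedDeriv_runoffH_of_critical hα0 hα1 hp hR]
    have e : -(-2 * (gapLinear α (β * (1 - β)) 1 / (4 * (1 - α) * (β * (1 - β)) ^ 2))) * (1 - α) /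
        (8 * Real.pi) = gapLinear α (β * (1 - β)) 1 / (4 * (β * (1 - β))) ^ 2 / Real.pi := by
      have := Real.pi_pos
      generalize β * (1 - β) = p at *
      field_simp
      norm_num
    rw [e, Real.sqrt_div (by positivity), Real.sqrt_div hL.le, Real.sqrt_sq (by positivity)]
    exact htail.symm.isEquivalent.trans (h.isEquivalent_of_critical hα2 hR)
  · have hsup : 1 / 2 < α ∨ gapQuadratic α (β * (1 - β)) 1 < 0 := by
      rcases lt_or_ge (1 / 2) α with h1 | h1
      · exact Or.inl h1
      · right
        rw [hfac]
        exact mul_neg_of_neg_of_pos (by linarith) (by linarith)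
    obtain ⟨s', hs', hs0'⟩ := h.exists_zero_lt_one_of_supercritical hsup
    obtain rfl : s' = s := by
      by_contra hne
      exact (h.gapCubic_pos hs ⟨hs'.1, hs'.2.le⟩ hs0 hne).ne' hs0'
    have hequiv := htail.symm.isEquivalent.trans (h.isEquivalent_of_supercritical hs' hs0')
    have hg := h.gapCubic_nonneg (Set.right_mem_Icc.mpr zero_le_one)
    have hq : quadFactor α 1 = 1 := by unfold quadFactor; ring
    rw [sub_eq_of_gapCubic_eq_zero hα0 hα1 hp hs0, hq]
    generalize gapCubic α (β * (1 - β)) (tailLevel α (β * (1 - β)) (runoffTail P Z X)) 1 = c at *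
    have e : c / (4 * (1 - α) * (β * (1 - β)) ^ 2 * 1) * (1 - α) / Real.pi =
        c / (2 * (β * (1 - β))) ^ 2 / Real.pi := by
      have := Real.pi_pos
      generalize β * (1 - β) = p at *
      field_simp
      norm_num
    rw [e, Real.sqrt_div (by positivity), Real.sqrt_div hg, Real.sqrt_sq (by positivity)]
    exact hequiv
  · have hR : 0 < gapQuadratic α (β * (1 - β)) 1 := by
      rw [hfac]
      exact mul_pos (by linarith) (by linarith)
    exact hM.lintegral_rootRunoff_rpow_lt_top hα0 hα1
      (h.summable_pow_mul_of_subcritical (by linarith) hR) hr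

end Main
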